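/- Let $\mathbb T=\mathbb R/\mathbb Z$ carry Lebesgue measure of total mass $1$, and write $\widehat f(n)=\int_{\mathbb T} f(t)e^{-2\pi i n t}\,dt$ for $n\in\mathbb Z$. For an interval of integers $[a,b]$ ($a\le b$) not containing $0$, let $\alpha([a,b])=\max\{|a|,|b|\}/\min\{|a|,|b|\}$. The Beurling–Malliavin density $\mathrm{BM}(S)$ of $S\subseteq\mathbb Z$ is the supremum of those $D\ge 0$ for which there exist pairwise disjoint nonempty integer intervals $I_n\subset\mathbb Z\setminus\{0\}$ ($n\ge1$) with $|S\cap I_n|\ge D|I_n|$ for all $n$ and $\sum_{n\ge1}(\alpha(I_n)-1)^2=\infty$. Let $A\subseteq\mathbb T$ be Lebesgue measurable with measure $|A|$. Then there is a set $S\subseteq\mathbb Z$ with $\mathrm{BM}(S)=|A|$ such that every $f\in L^2(\mathbb T)$ that vanishes a.e. on $A$ and satisfies $\widehat f(n)=0$ for all $n\notin S$ is $0$ a.e. Indeed, there is a unique probability measure $\mathbf P^A$ on $2^{\mathbb Z}$ (with the product $\sigma$-field) that is determinantal with the Toeplitz matrix $(j,k)\mapsto\widehat{\mathbf 1_A}(k-j)$,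 i.e. such that $$\mathbf P^A\bigl[\{S: F\subseteq S\}\bigr]=\det\bigl(\widehat{\mathbf 1_A}(k-j)\bigr)_{j,k\in F}\quad\text{for every finite } F\subset\mathbb Z,$$ and $\mathbf P^A$-a.e. $S\subseteq\mathbb Z$ has both properties: $\mathrm{BM}(S)=|A|$, and every $f\in L^2(\mathbb T)$ that vanishes a.e. on $A$ and satisfies $\widehat f(n)=0$ for all $n\notin S$ is $0$ a.e. -/

import Mathlib

open MeasureTheory

noncomputable section

/-- The unit Lebesgue measure on the circle `ℝ / ℤ` (Lebesgue measure normalized to total mass one,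
which is the measure used by Mathlib's `fourierCoeff`). -/
abbrev circleMeasure : Measure UnitAddCircle := AddCircle.haarAddCircle

/-- `P` is a determinantal probability measure on `2 ^ E` (with the product `σ`-algebra)
corresponding to the matrix `Q`: the probability that the random subset of `E` contains a given
finite set `F` is the determinant of the submatrix of `Q` indexed by `F`. -/
structure IsDeterminantal {E : Type*} [DecidableEq E]
    (P : Measure (Set E)) (Q : Matrix E E ℂ) : Prop where
  isProbabilityMeasure : IsProbabilityMeasure P
  prob_subset : ∀ F : Finset E,
    ((P.real {S : Set E | (F : Set E) ⊆ S} : ℝ) : ℂ) =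
      (Q.submatrix (fun e : F => (e : E)) (fun e : F => (e : E))).det

/-- The Toeplitz matrix `(j, k) ↦ (𝟙_A)^(k - j)` of a subset `A` of the circle, where
`fourierCoeff f n = ∫ t, exp (-2 π i n t) f t`. -/
def toeplitzMatrix (A : Set UnitAddCircle) : Matrix ℤ ℤ ℂ :=
  Matrix.of fun j k => fourierCoeff (A.indicator fun _ => (1 : ℂ)) (k - j)

/-- The aspect of the interval with end points `a` and `b`. -/
def aspect (a b : ℤ) : ℝ :=
  (max |(a : ℝ)| |(b : ℝ)|) / (min |(a : ℝ)| |(b : ℝ)|)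

/-- There are pairwise disjoint nonempty integer intervals `[a n, b n]`, none containing `0`, in
each of which `S` has proportion at least `D`, such that the sum of `(aspect - 1) ^ 2` over the
intervals is infinite. -/
def HasSubstantialIntervals (S : Set ℤ) (D : ℝ) : Prop :=
  ∃ a b : ℕ → ℤ,
    (∀ n, a n ≤ b n) ∧
    (∀ n, (0 : ℤ) ∉ Set.Icc (a n) (b n)) ∧
    (Pairwise fun m n => Disjoint (Set.Icc (a m) (b m)) (Set.Icc (a n) (b n))) ∧
    (∀ n, D * ((Set.Icc (a n) (b n)).ncard : ℝ) ≤ ((S ∩ Set.Icc (a n) (b n)).ncard : ℝ)) ∧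
    ∑' n, ENNReal.ofReal ((aspect (a n) (b n) - 1) ^ 2) = ⊤

/-- The Beurling–Malliavin density of a set of integers. The set whose supremum is taken
contains `0` and is bounded above by `1`. -/
def beurlingMalliavinDensity (S : Set ℤ) : ℝ :=
  sSup {D : ℝ | 0 ≤ D ∧ HasSubstantialIntervals S D}

/-- Every square-integrable function on the circle that vanishes a.e. on `A` and whose Fourier
coefficients vanish off `S` is zero a.e. -/
def IsUniquenessSet (A : Set UnitAddCircle) (S : Set ℤ) : Prop :=
  ∀ f : UnitAddCircle → ℂ, MemLp f 2 circleMeasure →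
    (∀ᵐ t ∂circleMeasure, t ∈ A → f t = 0) →
    (∀ n : ℤ, n ∉ S → fourierCoeff f n = 0) →
    f =ᵐ[circleMeasure] 0

end

noncomputable section

open scoped ComplexOrder Matrix

/-! The matrix `Q = toeplitzMatrix A` is multiplication by `𝟙_A` seen in the Fourier basis, and `1 -
Q` is the same object for `Aᶜ`; hence both have positive semidefinite finite sections. For such `Q`
the minors of `mixedMatrix` are nonnegative and add up correctly when an index is dropped, so they
are a consistent family of cylinder probabilities and define `P` on the compact space `2^ℤ`
(`exists_hasCylinderDet`). The inclusion events generate the product σ-field and form a π-system, so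
`P` is unique (`IsDeterminantal.eq`).

Uniqueness property. Complementing the random set replaces `A` by `Aᶜ`, so it is enough that almost
surely no nonzero `f ∈ L²(A)` has coefficients vanishing on `S`. If such an `f` has coefficient `1`
at some `e ∉ S`, condition on `S ∩ F = B`. The conditional probability of `e ∉ S` is the reciprocal
of a diagonal entry of an inverse matrix, and a variational argument bounds it by the energy of `f`
outside `insert e F` (`mixedMatrix_det_le`, `formDefect_toeplitzMatrix_le`). The bound is uniform in
`B`, so `f` may depend on `S`; as `F` exhausts `ℤ` the energy tends to `0` by Parseval.

Density. Inclusion probabilities are at most `|A|^{|F|}`, as if points were independent, and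
likewise for the complement. A Chernoff bound makes densities far from `|A|` exponentially unlikely
in the interval length (`exists_measure_density_ge_le`). By Borel–Cantelli, too dense intervals are
either short or very far from `0`, with summable `(α - 1)^2`, while dyadic blocks eventually have
density above any `D < |A|`. -/

/-- The matrix whose rows indexed by `B` are those of `Q` and whose other rows are those of
`1 - Q`. For a determinantal random set with kernel `Q`, its principal minors are the probabilities
of the cylinder events. -/
def mixedMatrix {ι : Type*} [DecidableEq ι] (Q : Matrix ι ι ℂ) (B : Set ι) : Matrix ι ι ℂ :=
  open Classical in Matrix.of fun i j => if i ∈ B then Q i j else (1 - Q) i j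

/-! ### Determinants and quadratic forms of finite positive contractions. -/

section FiniteMatrices

variable {ι : Type*} [Fintype ι] [DecidableEq ι]

lemma mixedMatrix_mulVec_of_mem (Q : Matrix ι ι ℂ) {B : Set ι} {i : ι} (hi : i ∈ B) (x : ι → ℂ) :
    (mixedMatrix Q B *ᵥ x) i = (Q *ᵥ x) i := by
  simp [mixedMatrix, Matrix.mulVec, dotProduct, hi]

lemma mixedMatrix_mulVec_of_notMem (Q : Matrix ι ι ℂ) {B : Set ι} {i : ι} (hi : i ∉ B)
    (x : ι → ℂ) : (mixedMatrix Q B *ᵥ x) i = x i - (Q *ᵥ x) i := by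
  have : (mixedMatrix Q B *ᵥ x) i = ((1 - Q) *ᵥ x) i := by
    simp [mixedMatrix, Matrix.mulVec, dotProduct, hi]
  rw [this, Matrix.sub_mulVec, Matrix.one_mulVec, Pi.sub_apply]

/-- The off-diagonal blocks are `C` and `-Cᴴ`, so the Schur complement is `D + Cᴴ A⁻¹ C`: the sign
makes the correction add to `D`. -/
lemma mixedMatrix_det_pos {Q : Matrix ι ι ℂ} (hQ : Q.PosDef) (h1 : (1 - Q).PosDef) (B : Set ι) :
    0 < (mixedMatrix Q B).det := by
  classical
  let e : {i // i ∈ B} ⊕ {i // i ∉ B} ≃ ι := Equiv.sumCompl (· ∈ B)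
  let A : Matrix {i // i ∈ B} {i // i ∈ B} ℂ := Q.submatrix (↑) (↑)
  let C : Matrix {i // i ∈ B} {i // i ∉ B} ℂ := Q.submatrix (↑) (↑)
  let D : Matrix {i // i ∉ B} {i // i ∉ B} ℂ := (1 - Q).submatrix (↑) (↑)
  have hA : A.PosDef := hQ.submatrix Subtype.val_injective
  have hD : D.PosDef := h1.submatrix Subtype.val_injective
  have hM : (mixedMatrix Q B).submatrix e e = Matrix.fromBlocks A C (-Cᴴ) D := by
    ext i j
    rcases i with ⟨i, hi⟩ | ⟨i, hi⟩ <;> rcases j with ⟨j, hj⟩ | ⟨j, hj⟩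
    · simp [e, mixedMatrix, hi, A]
    · simp [e, mixedMatrix, hi, C]
    · have hij : i ≠ j := fun h => hi (h ▸ hj)
      have := hQ.isHermitian.apply i j
      simp only [Matrix.submatrix_apply, mixedMatrix, Matrix.of_apply, e, Equiv.sumCompl_apply_inr,
        Equiv.sumCompl_apply_inl, if_neg hi, Matrix.fromBlocks_apply₂₁, Matrix.neg_apply,
        Matrix.conjTranspose_apply, C, Matrix.sub_apply, Matrix.one_apply_ne hij, this, zero_sub]
    · simp [e, mixedMatrix, hi, D]
  rw [← Matrix.det_submatrix_equiv_self e, hM]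
  let _ : Invertible A := hA.isUnit.invertible
  rw [Matrix.det_fromBlocks₁₁, Matrix.invOf_eq_nonsing_inv, Matrix.neg_mul, Matrix.neg_mul,
    sub_neg_eq_add]
  refine mul_pos hA.det_pos (Matrix.PosDef.det_pos ?_)
  exact hD.add_posSemidef (hA.inv.posSemidef.conjTranspose_mul_mul_same C)

omit [DecidableEq ι] in
lemma re_form_comm {Q : Matrix ι ι ℂ} (hQ : Q.IsHermitian) (x y : ι → ℂ) :
    (star x ⬝ᵥ Q *ᵥ y).re = (star y ⬝ᵥ Q *ᵥ x).re := by
  have : star x ⬝ᵥ Q *ᵥ y = star (star y ⬝ᵥ Q *ᵥ x) := by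
    rw [Matrix.star_dotProduct, Matrix.star_mulVec, hQ.eq, Matrix.dotProduct_mulVec]
  rw [this]; simp

omit [DecidableEq ι] in
lemma re_form_sub_smul {Q : Matrix ι ι ℂ} (hQ : Q.IsHermitian) (x y : ι → ℂ) (s : ℝ) :
    (star (x - (s : ℂ) • y) ⬝ᵥ Q *ᵥ (x - (s : ℂ) • y)).re =
      (star x ⬝ᵥ Q *ᵥ x).re - 2 * s * (star x ⬝ᵥ Q *ᵥ y).re +
        s ^ 2 * (star y ⬝ᵥ Q *ᵥ y).re := by
  have h := re_form_comm hQ x y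
  simp only [star_sub, star_smul, Matrix.mulVec_sub, Matrix.mulVec_smul, sub_dotProduct,
    dotProduct_sub, smul_dotProduct, dotProduct_smul, Complex.sub_re, smul_eq_mul,
    Complex.star_def, Complex.conj_ofReal, Complex.re_ofReal_mul]
  rw [← h]; ring

omit [DecidableEq ι] in
lemma re_form_sub {Q : Matrix ι ι ℂ} (hQ : Q.IsHermitian) (x y : ι → ℂ) :
    (star (x - y) ⬝ᵥ Q *ᵥ (x - y)).re =
      (star x ⬝ᵥ Q *ᵥ x).re - 2 * (star x ⬝ᵥ Q *ᵥ y).re + (star y ⬝ᵥ Q *ᵥ y).re := by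
  simpa using re_form_sub_smul hQ x y 1

lemma re_form_one (x : ι → ℂ) :
    (star x ⬝ᵥ (1 : Matrix ι ι ℂ) *ᵥ x).re = ∑ i, ‖x i‖ ^ 2 := by
  rw [Matrix.one_mulVec]
  simp only [dotProduct, Complex.re_sum, Pi.star_apply, Complex.star_def]
  refine Finset.sum_congr rfl fun i _ => ?_
  rw [mul_comm, Complex.mul_conj, Complex.ofReal_re, Complex.normSq_eq_norm_sq]

lemma re_form_le {Q : Matrix ι ι ℂ} (h1 : (1 - Q).PosSemidef) (x : ι → ℂ) :
    (star x ⬝ᵥ Q *ᵥ x).re ≤ ∑ i, ‖x i‖ ^ 2 := by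
  have h := h1.re_dotProduct_nonneg x
  rw [Matrix.sub_mulVec, dotProduct_sub, map_sub, sub_nonneg] at h
  rw [← re_form_one]
  exact h

/-- The quadratic form of the projection to the coordinates off `B`, minus that of `Q`. -/
def formDefect (Q : Matrix ι ι ℂ) (B : Set ι) (z : ι → ℂ) : ℝ :=
  (∑ i, Bᶜ.indicator (fun i => ‖z i‖ ^ 2) i) - (star z ⬝ᵥ Q *ᵥ z).re

/-- Split `z = v + w` along `B` and its complement. Since `Q z` vanishes on `B`, the form of `Q` at
`w` is that at `z` plus that at `v`; it is also at most `‖w‖²`, because `Q ≤ 1`. -/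
lemma formDefect_nonneg {Q : Matrix ι ι ℂ} (hQ : Q.PosSemidef) (h1 : (1 - Q).PosSemidef)
    {B : Set ι} {z : ι → ℂ} (hz : ∀ i ∈ B, (Q *ᵥ z) i = 0) : 0 ≤ formDefect Q B z := by
  classical
  let w : ι → ℂ := Bᶜ.indicator z
  let v : ι → ℂ := B.indicator z
  have hw : w = z - v := by
    ext i; by_cases hi : i ∈ B <;> simp [w, v, hi]
  have hv : star v ⬝ᵥ Q *ᵥ z = 0 := by
    refine Finset.sum_eq_zero fun i _ => ?_
    by_cases hi : i ∈ B
    · simp [hz i hi]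
    · simp [v, hi]
  have h2 := re_form_le h1 w
  have h3 := hQ.re_dotProduct_nonneg v
  rw [RCLike.re_eq_complex_re] at h3
  have h4 := re_form_sub hQ.isHermitian z v
  rw [re_form_comm hQ.isHermitian z v, hv, ← hw] at h4
  have h5 : ∑ i, ‖w i‖ ^ 2 = ∑ i, Bᶜ.indicator (fun i => ‖z i‖ ^ 2) i := by
    refine Finset.sum_congr rfl fun i _ => ?_
    by_cases hi : i ∈ B <;> simp [w, hi]
  rw [formDefect, ← h5]
  simp at h4
  linarith

/-- The vector `y` represents evaluation at `e` for the polarization of `formDefect`; this is `key`,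
read off row by row from the equation for `y`. -/
lemma formDefect_sub_smul {Q : Matrix ι ι ℂ} (hQ : Q.IsHermitian) {B : Set ι} {e : ι}
    (he : e ∉ B) (x : ι → ℂ) {y : ι → ℂ} (hy : mixedMatrix Q B *ᵥ y = Pi.single e 1) (s : ℝ) :
    formDefect Q B (x - (s : ℂ) • y) =
      formDefect Q B x - 2 * s * (x e).re + s ^ 2 * (y e).re := by
  classical
  have key : ∀ z : ι → ℂ, (∑ i, Bᶜ.indicator (fun i => (star (z i) * y i).re) i) -
      (star z ⬝ᵥ Q *ᵥ y).re = (z e).re := by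
    intro z
    have h1 : (z e).re = ∑ i, (star (z i) * (Pi.single e 1 : ι → ℂ) i).re := by
      rw [Finset.sum_eq_single e] <;> simp +contextual
    rw [h1, dotProduct, Complex.re_sum, ← Finset.sum_sub_distrib]
    refine Finset.sum_congr rfl fun i _ => ?_
    by_cases hi : i ∈ B
    · have h2 := congrFun hy i
      rw [mixedMatrix_mulVec_of_mem Q hi] at h2
      have hie : i ≠ e := fun h => he (h ▸ hi)
      rw [h2]; simp [hi, hie]
    · have h2 := congrFun hy i
      rw [mixedMatrix_mulVec_of_notMem Q hi] at h2
      rw [← h2, Set.indicator_of_mem (by simpa using hi), mul_sub, Complex.sub_re, Pi.star_apply]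
  have hx := key x
  have hyy := key y
  have h3 : ∑ i, Bᶜ.indicator (fun i => ‖(x - (s : ℂ) • y) i‖ ^ 2) i =
      (∑ i, Bᶜ.indicator (fun i => ‖x i‖ ^ 2) i) -
        2 * s * (∑ i, Bᶜ.indicator (fun i => (star (x i) * y i).re) i) +
        s ^ 2 * ∑ i, Bᶜ.indicator (fun i => (star (y i) * y i).re) i := by
    rw [Finset.mul_sum, Finset.mul_sum, ← Finset.sum_sub_distrib, ← Finset.sum_add_distrib]
    refine Finset.sum_congr rfl fun i _ => ?_
    by_cases hi : i ∈ B
    · simp [hi]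
    · simp only [Set.mem_compl_iff, hi, not_false_eq_true, Set.indicator_of_mem, Pi.sub_apply,
        Pi.smul_apply, smul_eq_mul, ← Complex.normSq_eq_norm_sq, Complex.normSq_apply]
      simp
      ring
  unfold formDefect
  rw [h3, re_form_sub_smul hQ]
  linear_combination (-2 * s) * hx + s ^ 2 * hyy

/-- A kernel vector `x` of `N` vanishes off `B` while `Q x` vanishes on `B`, so the form of `Q` is
zero at `x` and positivity forces `x = 0`. -/
lemma exists_mulVec_eq_zero_on {Q : Matrix ι ι ℂ} (hQ : Q.PosDef) (B : Set ι) (u : ι → ℂ) :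
    ∃ x : ι → ℂ, (∀ i ∉ B, x i = u i) ∧ ∀ i ∈ B, (Q *ᵥ x) i = 0 := by
  classical
  let N : Matrix ι ι ℂ := Matrix.of fun i j => if i ∈ B then Q i j else (1 : Matrix ι ι ℂ) i j
  have hB : ∀ i ∈ B, ∀ x : ι → ℂ, (N *ᵥ x) i = (Q *ᵥ x) i := by
    intro i hi x; simp [N, Matrix.mulVec, dotProduct, hi]
  have hBc : ∀ i ∉ B, ∀ x : ι → ℂ, (N *ᵥ x) i = x i := by
    intro i hi x; simp [N, Matrix.mulVec, dotProduct, hi, Matrix.one_apply]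
  have hinj : Function.Injective N.mulVecLin := by
    rw [← LinearMap.ker_eq_bot, LinearMap.ker_eq_bot']
    intro x hx
    replace hx : N *ᵥ x = 0 := hx
    by_contra hne
    have hpos := hQ.re_dotProduct_pos hne
    have : star x ⬝ᵥ Q *ᵥ x = 0 := by
      refine Finset.sum_eq_zero fun i _ => ?_
      by_cases hi : i ∈ B
      · rw [← hB i hi, hx]; simp
      · have := hBc i hi x
        rw [hx] at this
        simp [← this]
    rw [this] at hpos
    simp at hpos
  obtain ⟨x, hx⟩ := LinearMap.injective_iff_surjective.mp hinj (Bᶜ.indicator u)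
  replace hx : N *ᵥ x = Bᶜ.indicator u := hx
  refine ⟨x, fun i hi => ?_, fun i hi => ?_⟩
  · rw [← hBc i hi x, hx]; simp [hi]
  · rw [← hB i hi x, hx]; simp [hi]

/-- By Cramer's rule `y e` is the ratio of the two determinants. With `u` extended to `x` so that `Q
x` vanishes on `B`, the parabola `s ↦ formDefect Q B (x - s • y)` is nonnegative, and its
discriminant gives `1 ≤ (y e).re * formDefect Q B x`. -/
lemma mixedMatrix_det_le_of_posDef {Q : Matrix ι ι ℂ} (hQ : Q.PosDef) (h1 : (1 - Q).PosDef)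
    {B : Set ι} {e : ι} (he : e ∉ B) {u : ι → ℂ} (hu : u e = 1) {ε : ℝ}
    (hε : ∀ x : ι → ℂ, (∀ i ∉ B, x i = u i) → formDefect Q B x ≤ ε) :
    (mixedMatrix Q B).det.re ≤ ε * ((mixedMatrix Q B).updateRow e (Pi.single e 1)).det.re := by
  classical
  set M := mixedMatrix Q B with hM
  have hdet : 0 < M.det := mixedMatrix_det_pos hQ h1 B
  have hunit : IsUnit M.det := hdet.ne'.isUnit
  set y : ι → ℂ := M⁻¹ *ᵥ Pi.single e 1 with hy
  have hMy : M *ᵥ y = Pi.single e 1 := by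
    rw [hy, Matrix.mulVec_mulVec, Matrix.mul_nonsing_inv _ hunit, Matrix.one_mulVec]
  have hye : (M.updateRow e (Pi.single e 1)).det = M.det * y e := by
    rw [← Matrix.adjugate_apply, hy, Matrix.mulVec_single_one, Matrix.col_apply, Matrix.inv_def,
      Matrix.smul_apply, smul_eq_mul, Ring.inverse_eq_inv', mul_inv_cancel_left₀ hdet.ne']
  obtain ⟨hre, him⟩ := Complex.pos_iff.mp hdet
  have hyre : ((M.updateRow e (Pi.single e 1)).det).re = M.det.re * (y e).re := by
    rw [hye, Complex.mul_re, ← him]; ring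
  obtain ⟨x, hx, hx0⟩ := exists_mulVec_eq_zero_on hQ B u
  have hxe : x e = 1 := by rw [hx e he, hu]
  have hquad : ∀ s : ℝ, 0 ≤ (y e).re * (s * s) + (-2) * s + formDefect Q B x := by
    intro s
    have h := formDefect_nonneg hQ.posSemidef h1.posSemidef (B := B) (z := x - (s : ℂ) • y) ?_
    · rw [formDefect_sub_smul hQ.isHermitian he x hMy, hxe, Complex.one_re] at h
      linarith
    · intro i hi
      have hie : i ≠ e := fun h => he (h ▸ hi)
      have h2 := congrFun hMy i
      rw [hM, mixedMatrix_mulVec_of_mem Q hi] at h2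
      rw [Matrix.mulVec_sub, Matrix.mulVec_smul, Pi.sub_apply, Pi.smul_apply, hx0 i hi, h2]
      simp [hie]
  have hdisc := discrim_le_zero hquad
  rw [discrim] at hdisc
  have hmain : 1 ≤ (y e).re * formDefect Q B x := by linarith
  have hxε := hε x hx
  have hy0 : 0 ≤ (y e).re := by
    have hxn := formDefect_nonneg hQ.posSemidef h1.posSemidef hx0
    by_contra hneg
    nlinarith
  rw [hyre]
  have : 1 ≤ (y e).re * ε := hmain.trans (mul_le_mul_of_nonneg_left hxε hy0)
  calc M.det.re = M.det.re * 1 := (mul_one _).symm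
    _ ≤ M.det.re * ((y e).re * ε) := mul_le_mul_of_nonneg_left this hre.le
    _ = _ := by ring

/-- Convex combination of `Q` with `1 / 2`. -/
def regularize (Q : Matrix ι ι ℂ) (t : ℝ) : Matrix ι ι ℂ :=
  ((1 - t : ℝ) : ℂ) • Q + ((t / 2 : ℝ) : ℂ) • (1 : Matrix ι ι ℂ)

-- Since regularization commutes with `Q ↦ 1 - Q`, both become positive definite for `0 < t < 1`;
-- the semidefinite case follows as `t → 0+`.
omit [Fintype ι] in
lemma one_sub_regularize (Q : Matrix ι ι ℂ) (t : ℝ) :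
    1 - regularize Q t = regularize (1 - Q) t := by
  unfold regularize
  ext i j
  simp only [Matrix.sub_apply, Matrix.add_apply, Matrix.smul_apply, smul_eq_mul]
  push_cast; ring

omit [Fintype ι] in
lemma regularize_posDef {Q : Matrix ι ι ℂ} (hQ : Q.PosSemidef) {t : ℝ} (ht : t ∈ Set.Ioo (0 : ℝ) 1) :
    (regularize Q t).PosDef := by
  refine Matrix.PosDef.posSemidef_add (hQ.smul ?_) (Matrix.PosDef.one.smul ?_)
  · exact_mod_cast (sub_pos.mpr ht.2).le
  · exact_mod_cast half_pos ht.1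

omit [Fintype ι] in
lemma continuous_regularize (Q : Matrix ι ι ℂ) : Continuous (regularize Q) := by
  unfold regularize; fun_prop

omit [Fintype ι] in
lemma continuous_mixedMatrix (B : Set ι) :
    Continuous fun Q : Matrix ι ι ℂ => mixedMatrix Q B := by
  classical
  refine continuous_matrix fun i j => ?_
  by_cases hi : i ∈ B
  · simp only [mixedMatrix, Matrix.of_apply, if_pos hi]; fun_prop
  · simp only [mixedMatrix, Matrix.of_apply, if_neg hi, Matrix.sub_apply]; fun_prop

omit [Fintype ι] in
lemma regularize_zero (Q : Matrix ι ι ℂ) : regularize Q 0 = Q := by simp [regularize]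

open Filter Topology in
lemma mixedMatrix_det_nonneg {Q : Matrix ι ι ℂ} (hQ : Q.PosSemidef) (h1 : (1 - Q).PosSemidef)
    (B : Set ι) : 0 ≤ (mixedMatrix Q B).det := by
  have hc : Continuous fun t => (mixedMatrix (regularize Q t) B).det :=
    ((continuous_mixedMatrix B).comp (continuous_regularize Q)).matrix_det
  have ht : Tendsto (fun t => (mixedMatrix (regularize Q t) B).det) (𝓝[>] 0)
      (𝓝 (mixedMatrix Q B).det) := by
    have := (hc.tendsto 0).mono_left (nhdsWithin_le_nhds (s := Set.Ioi 0))
    rwa [regularize_zero] at this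
  refine ge_of_tendsto ht ?_
  filter_upwards [Ioo_mem_nhdsGT (zero_lt_one' ℝ)] with t ht
  exact (mixedMatrix_det_pos (regularize_posDef hQ ht)
    (one_sub_regularize Q t ▸ regularize_posDef h1 ht) B).le

lemma formDefect_regularize_le (Q : Matrix ι ι ℂ) (B : Set ι) (x : ι → ℂ) {t : ℝ}
    (ht : t ∈ Set.Ioo (0 : ℝ) 1) :
    formDefect (regularize Q t) B x ≤
      (1 - t) * formDefect Q B x + t * ∑ i, Bᶜ.indicator (fun i => ‖x i‖ ^ 2) i := by
  have h : (star x ⬝ᵥ regularize Q t *ᵥ x).re =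
      (1 - t) * (star x ⬝ᵥ Q *ᵥ x).re + t / 2 * ∑ i, ‖x i‖ ^ 2 := by
    rw [← re_form_one]
    simp only [regularize, Matrix.add_mulVec, Matrix.smul_mulVec, dotProduct_add, dotProduct_smul,
      Complex.add_re, smul_eq_mul, Complex.re_ofReal_mul]
  have h0 : 0 ≤ t / 2 * ∑ i, ‖x i‖ ^ 2 :=
    mul_nonneg (half_pos ht.1).le (Finset.sum_nonneg fun _ _ => by positivity)
  unfold formDefect
  rw [h]; linarith

open Filter Topology in
/-- The probability of a cylinder event shrinks at least by the factor `ε` when one more element is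
required to be absent, provided that `u` extended in any way to `B` nearly attains the bound
`Q ≤ 1`. -/
lemma mixedMatrix_det_le {Q : Matrix ι ι ℂ} (hQ : Q.PosSemidef) (h1 : (1 - Q).PosSemidef)
    {B : Set ι} {e : ι} (he : e ∉ B) {u : ι → ℂ} (hu : u e = 1) {ε : ℝ}
    (hε : ∀ x : ι → ℂ, (∀ i ∉ B, x i = u i) → formDefect Q B x ≤ ε) :
    (mixedMatrix Q B).det.re ≤ ε * ((mixedMatrix Q B).updateRow e (Pi.single e 1)).det.re := by
  -- The error of regularization involves `x` only off `B`, where it equals `u`; hence `K` serves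
  -- every `x` and `t`.
  set K : ℝ := ∑ i, Bᶜ.indicator (fun i => ‖u i‖ ^ 2) i
  have hM : Continuous fun t => mixedMatrix (regularize Q t) B :=
    (continuous_mixedMatrix B).comp (continuous_regularize Q)
  have hc1 : Continuous fun t => (mixedMatrix (regularize Q t) B).det.re :=
    Complex.continuous_re.comp hM.matrix_det
  have hc2 : Continuous fun t => ((1 - t) * ε + t * K) *
      ((mixedMatrix (regularize Q t) B).updateRow e (Pi.single e 1)).det.re := by
    refine Continuous.mul (by fun_prop) (Complex.continuous_re.comp ?_)
    exact (hM.matrix_updateRow e continuous_const).matrix_det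
  have ht1 := (hc1.tendsto 0).mono_left (nhdsWithin_le_nhds (s := Set.Ioi 0))
  have ht2 := (hc2.tendsto 0).mono_left (nhdsWithin_le_nhds (s := Set.Ioi 0))
  simp only [regularize_zero, sub_zero, one_mul, zero_mul, add_zero] at ht1 ht2
  refine le_of_tendsto_of_tendsto ht1 ht2 ?_
  filter_upwards [Ioo_mem_nhdsGT (zero_lt_one' ℝ)] with t ht
  refine mixedMatrix_det_le_of_posDef (regularize_posDef hQ ht)
    (one_sub_regularize Q t ▸ regularize_posDef h1 ht) he hu fun x hx => ?_
  refine (formDefect_regularize_le Q B x ht).trans ?_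
  have hK : ∑ i, Bᶜ.indicator (fun i => ‖x i‖ ^ 2) i = K := by
    refine Finset.sum_congr rfl fun i _ => ?_
    by_cases hi : i ∈ B
    · simp [hi]
    · simp [hi, hx i hi]
  rw [hK]
  have := mul_le_mul_of_nonneg_left (hε x hx) (sub_pos.mpr ht.2).le
  linarith

omit [Fintype ι] in
lemma mixedMatrix_compl (Q : Matrix ι ι ℂ) (B : Set ι) :
    mixedMatrix Q Bᶜ = mixedMatrix (1 - Q) B := by
  ext i j
  by_cases hi : i ∈ B <;> simp [mixedMatrix, hi]

omit [Fintype ι] in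
lemma mixedMatrix_submatrix (Q : Matrix ι ι ℂ) (B : Set ι) {κ : Type*} [DecidableEq κ] {f : κ → ι}
    (hf : Function.Injective f) :
    (mixedMatrix Q B).submatrix f f = mixedMatrix (Q.submatrix f f) (f ⁻¹' B) := by
  ext i j
  by_cases hi : f i ∈ B <;> simp [mixedMatrix, hi, Matrix.one_apply, hf.eq_iff]

/-- The two matrices differ only in row `e`, where their rows sum to the unit vector; the
determinant is linear in that row. -/
lemma mixedMatrix_det_add {Q : Matrix ι ι ℂ} {B : Set ι} {e : ι} (he : e ∉ B) :
    (mixedMatrix Q B).det + (mixedMatrix Q (insert e B)).det =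
      ((mixedMatrix Q B).updateRow e (Pi.single e 1)).det := by
  have h1 : mixedMatrix Q B = (mixedMatrix Q B).updateRow e ((1 - Q) e) := by
    refine (Matrix.updateRow_eq_self _ e).symm.trans ?_
    congr 1
    ext j; simp [mixedMatrix, he]
  have h2 : mixedMatrix Q (insert e B) = (mixedMatrix Q B).updateRow e (Q e) := by
    ext i j
    by_cases hi : i = e
    · subst hi; simp [mixedMatrix]
    · have : i ∈ insert e B ↔ i ∈ B := by simp [hi]
      by_cases hB : i ∈ B
      · simp [mixedMatrix, hi, this.mpr hB, hB]
      · simp [mixedMatrix, hi, mt this.mp hB, hB]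
  have h3 : (Pi.single e 1 : ι → ℂ) = (1 - Q) e + Q e := by
    ext j; simp [Matrix.one_apply, Pi.single_apply, eq_comm]
  rw [h3, Matrix.det_updateRow_add, ← h1, ← h2]

lemma det_updateRow_single_eq (M : Matrix ι ι ℂ) (e : ι) {κ : Type*} [Fintype κ] [DecidableEq κ]
    (f : κ ≃ {i // i ≠ e}) :
    (M.updateRow e (Pi.single e 1)).det =
      (M.submatrix (fun k => (f k : ι)) (fun k => (f k : ι))).det := by
  rw [Matrix.twoBlockTriangular_det _ (fun i => i ≠ e)]
  · have h2 : ((M.updateRow e (Pi.single e 1)).toSquareBlockProp fun i => ¬ i ≠ e).det = 1 := by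
      let _ : Unique {i // ¬ i ≠ e} := ⟨⟨⟨e, by simp⟩⟩, fun i => Subtype.ext (not_not.mp i.2)⟩
      rw [Matrix.det_unique]
      have hd : ((default : {i // ¬ i ≠ e}) : ι) = e := rfl
      change M.updateRow e (Pi.single e 1) _ _ = 1
      rw [hd]; simp
    rw [h2, mul_one, ← Matrix.det_submatrix_equiv_self f]
    congr 1
    ext i j
    simp [Matrix.toSquareBlockProp, Matrix.updateRow_ne (f i).2]
  · intro i hi j hj
    obtain rfl : i = e := not_not.mp hi
    simp [hj]

end FiniteMatrices

/-! ### Cylinder probabilities of a kernel on an arbitrary index set. -/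

section CylinderDeterminants

variable {E : Type*} [DecidableEq E]

/-- The finite principal submatrix of `Q` with rows and columns in `F`. -/
abbrev principal (Q : Matrix E E ℂ) (F : Finset E) : Matrix F F ℂ :=
  Q.submatrix (fun e : F => (e : E)) (fun e : F => (e : E))

/-- All finite principal submatrices of `Q` and of `1 - Q` are positive semidefinite. -/
structure IsPosContraction (Q : Matrix E E ℂ) : Prop where
  posSemidef : ∀ F : Finset E, (principal Q F).PosSemidef
  one_sub : ∀ F : Finset E, (principal (1 - Q) F).PosSemidef

/-- The probability that the determinantal random set with kernel `Q` agrees with `B` on `F`. -/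
def cylinderDet (Q : Matrix E E ℂ) (F : Finset E) (B : Set E) : ℝ :=
  (principal (mixedMatrix Q B) F).det.re

lemma IsPosContraction.one_sub_self {Q : Matrix E E ℂ} (hQ : IsPosContraction Q) :
    IsPosContraction (1 - Q) :=
  ⟨hQ.one_sub, by simpa using hQ.posSemidef⟩

lemma one_sub_submatrix (Q : Matrix E E ℂ) (F : Finset E) :
    principal (1 - Q) F = 1 - principal Q F := by
  ext i j; simp [Matrix.one_apply]

lemma cylinderDet_eq (Q : Matrix E E ℂ) (F : Finset E) (B : Set E) :
    cylinderDet Q F B =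
      (mixedMatrix (principal Q F) ((fun e : F => (e : E)) ⁻¹' B)).det.re := by
  rw [cylinderDet, principal, mixedMatrix_submatrix _ _ Subtype.coe_injective]

lemma cylinderDet_nonneg {Q : Matrix E E ℂ} (hQ : IsPosContraction Q) (F : Finset E) (B : Set E) :
    0 ≤ cylinderDet Q F B := by
  rw [cylinderDet_eq]
  exact (Complex.nonneg_iff.mp (mixedMatrix_det_nonneg (hQ.posSemidef F)
    (one_sub_submatrix Q F ▸ hQ.one_sub F) _)).1

lemma cylinderDet_empty (Q : Matrix E E ℂ) (B : Set E) : cylinderDet Q ∅ B = 1 := by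
  simp [cylinderDet]

lemma cylinderDet_compl (Q : Matrix E E ℂ) (F : Finset E) (B : Set E) :
    cylinderDet Q F Bᶜ = cylinderDet (1 - Q) F B := by
  rw [cylinderDet, cylinderDet, mixedMatrix_compl]

lemma cylinderDet_congr (Q : Matrix E E ℂ) {F : Finset E} {B B' : Set E}
    (h : ∀ i ∈ F, i ∈ B ↔ i ∈ B') : cylinderDet Q F B = cylinderDet Q F B' := by
  have hB : (fun e : F => (e : E)) ⁻¹' B = (fun e : F => (e : E)) ⁻¹' B' :=
    Set.ext fun i => h i i.2
  rw [cylinderDet_eq, cylinderDet_eq, hB]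

/-- Writes the minor on `F` as a determinant of the size of `insert e F`, so that the finite-matrix
lemmas compare the two cylinders. -/
lemma cylinderDet_eq_updateRow (Q : Matrix E E ℂ) {F : Finset E} (B : Set E) {e : E} (he : e ∉ F) :
    cylinderDet Q F B = ((mixedMatrix (principal Q (insert e F))
      (Subtype.val ⁻¹' B)).updateRow ⟨e, Finset.mem_insert_self e F⟩
        (Pi.single ⟨e, Finset.mem_insert_self e F⟩ 1)).det.re := by
  have hne : ∀ i : ↥F, (i : E) ≠ e := fun i h => he (h ▸ i.2)
  let f : ↥F ≃ {i : ↥(insert e F : Finset E) // i ≠ ⟨e, Finset.mem_insert_self e F⟩} :=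
    { toFun := fun i => ⟨⟨i, Finset.mem_insert_of_mem i.2⟩, fun h => hne i (congrArg (·.1) h)⟩
      invFun := fun i => ⟨i.1.1, (Finset.mem_insert.mp i.1.2).resolve_left
        fun h => i.2 (Subtype.ext h)⟩
      left_inv := fun i => rfl
      right_inv := fun i => rfl }
  rw [det_updateRow_single_eq _ _ f, cylinderDet, ← mixedMatrix_submatrix _ _ Subtype.val_injective]
  rfl

lemma cylinderDet_add (Q : Matrix E E ℂ) {F : Finset E} {B : Set E} {e : E} (he : e ∉ F)
    (heB : e ∉ B) :
    cylinderDet Q (insert e F) B + cylinderDet Q (insert e F) (insert e B) =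
      cylinderDet Q F B := by
  rw [cylinderDet_eq_updateRow Q B he, cylinderDet_eq, cylinderDet_eq, ← Complex.add_re,
    ← mixedMatrix_det_add (by exact heB)]
  have hB : (fun i : ↥(insert e F : Finset E) => (i : E)) ⁻¹' (insert e B) =
      insert ⟨e, Finset.mem_insert_self e F⟩ (Subtype.val ⁻¹' B) := by
    ext i
    simp [Subtype.ext_iff]
  rw [hB]

lemma cylinderDet_insert_le {Q : Matrix E E ℂ} (hQ : IsPosContraction Q) {F : Finset E}
    {B : Set E} {e : E} (he : e ∉ F) (heB : e ∉ B) {u : E → ℂ} (hu : u e = 1) {ε : ℝ}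
    (hε : ∀ x : ↥(insert e F : Finset E) → ℂ, (∀ i : ↥(insert e F : Finset E), (i : E) ∉ B → x i = u i) →
      formDefect (principal Q (insert e F)) (Subtype.val ⁻¹' B) x ≤ ε) :
    cylinderDet Q (insert e F) B ≤ ε * cylinderDet Q F B := by
  rw [cylinderDet_eq_updateRow Q B he, cylinderDet_eq]
  exact mixedMatrix_det_le (hQ.posSemidef _) (one_sub_submatrix Q _ ▸ hQ.one_sub _)
    (u := fun i => u i) heB hu hε

/-- With `B = ∅` no coordinate is free: `x` must be the unit vector at `e`, whose defect is one
minus the diagonal entry. -/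
lemma cylinderDet_insert_le_of_disjoint {Q : Matrix E E ℂ} (hQ : IsPosContraction Q)
    {F : Finset E} {e : E} (he : e ∉ F) :
    cylinderDet Q (insert e F) ∅ ≤ (1 - (Q e e).re) * cylinderDet Q F ∅ := by
  refine cylinderDet_insert_le hQ he (Set.notMem_empty e) (u := Pi.single e 1) (by simp) ?_
  intro x hx
  have hx' : x = (Pi.single (⟨e, Finset.mem_insert_self e F⟩ : ↥(insert e F : Finset E)) (1 : ℂ) : ↥(insert e F : Finset E) → ℂ) := by
    ext i
    rw [hx i (Set.notMem_empty _)]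
    by_cases hi : i = ⟨e, Finset.mem_insert_self e F⟩
    · subst hi; simp
    · have : (i : E) ≠ e := fun h => hi (Subtype.ext h)
      simp [hi, this]
  have h2 : star (Pi.single ⟨e, Finset.mem_insert_self e F⟩ 1 : ↥(insert e F : Finset E) → ℂ) =
      Pi.single ⟨e, Finset.mem_insert_self e F⟩ 1 := by
    rw [← Pi.single_star]; simp
  rw [formDefect, hx', Matrix.mulVec_single_one, h2, single_one_dotProduct, Matrix.col_apply]
  refine sub_le_sub_right (le_of_eq ?_) _
  rw [Finset.sum_eq_single ⟨e, Finset.mem_insert_self e F⟩] <;> simp +contextual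

lemma cylinderDet_empty_le_prod {Q : Matrix E E ℂ} (hQ : IsPosContraction Q) (F : Finset E) :
    cylinderDet Q F ∅ ≤ ∏ e ∈ F, (1 - (Q e e).re) := by
  induction F using Finset.induction_on with
  | empty => simp [cylinderDet_empty]
  | insert e F he ih =>
    rw [Finset.prod_insert he]
    refine (cylinderDet_insert_le_of_disjoint hQ he).trans (mul_le_mul_of_nonneg_left ih ?_)
    have h := (hQ.one_sub {e}).diag_nonneg (i := ⟨e, Finset.mem_singleton_self e⟩)
    have := (Complex.nonneg_iff.mp h).1
    simpa using this

lemma cylinderDet_self {Q : Matrix E E ℂ} (hQ : IsPosContraction Q) (F : Finset E) :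
    ((cylinderDet Q F F : ℝ) : ℂ) = (principal Q F).det := by
  have h : principal (mixedMatrix Q F) F = principal Q F := by
    ext i j; simp [mixedMatrix]
  rw [cylinderDet]
  have := (hQ.posSemidef F).det_nonneg
  rw [h]
  exact Complex.ext rfl (Complex.nonneg_iff.mp this).2

end CylinderDeterminants

/-! ### Construction and uniqueness of the determinantal measure. -/

section Existence

variable {E : Type*} [DecidableEq E]

/-- The subset of `F` with indicator function `x`. -/
def boolSupport {F : Finset E} (x : F → Bool) : Set E := {e | ∃ h : e ∈ F, x ⟨e, h⟩ = true}

omit [DecidableEq E] in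
lemma mem_boolSupport {F : Finset E} {x : F → Bool} {e : E} (h : e ∈ F) :
    e ∈ boolSupport x ↔ x ⟨e, h⟩ = true :=
  ⟨fun ⟨_, h'⟩ => h', fun h' => ⟨h, h'⟩⟩

/-- The law of the restriction to `F` of the determinantal random set with kernel `Q`. -/
def cylinderMeasure (Q : Matrix E E ℂ) (F : Finset E) : Measure (∀ _ : F, Bool) :=
  ∑ x : F → Bool, ENNReal.ofReal (cylinderDet Q F (boolSupport x)) • Measure.dirac x

lemma cylinderMeasure_singleton (Q : Matrix E E ℂ) (F : Finset E) (x : F → Bool) :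
    cylinderMeasure Q F {x} = ENNReal.ofReal (cylinderDet Q F (boolSupport x)) := by
  rw [cylinderMeasure, Measure.coe_finsetSum, Finset.sum_apply, Finset.sum_eq_single x]
  · simp
  · intro y _ hy
    simp [hy]
  · simp

instance (Q : Matrix E E ℂ) (F : Finset E) : IsFiniteMeasure (cylinderMeasure Q F) := by
  refine ⟨?_⟩
  rw [cylinderMeasure, Measure.coe_finsetSum, Finset.sum_apply]
  simp

/-- The fibre over `y` has two points, without and with `e`, and `cylinderDet_add` sums their
masses. -/
lemma cylinderMeasure_map_insert {Q : Matrix E E ℂ} (hQ : IsPosContraction Q) {J : Finset E}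
    {e : E} (he : e ∉ J) :
    cylinderMeasure Q J = (cylinderMeasure Q (insert e J)).map
      (Finset.restrict₂ (π := fun _ => Bool) (Finset.subset_insert e J)) := by
  refine Measure.ext_iff_singleton.mpr fun y => ?_
  rw [Measure.map_apply (by fun_prop) (measurableSet_singleton y)]
  let x : Bool → (∀ _ : ↥(insert e J : Finset E), Bool) :=
    fun b i => if h : (i : E) ∈ J then y ⟨i, h⟩ else b
  have hpre : Finset.restrict₂ (π := fun _ => Bool) (Finset.subset_insert e J) ⁻¹' {y} =
      {x false} ∪ {x true} := by
    ext z
    simp only [Set.mem_preimage, Set.mem_singleton_iff, Set.mem_union]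
    constructor
    · intro hz
      have hz' : ∀ b, z ⟨e, Finset.mem_insert_self e J⟩ = b → z = x b := by
        intro b hb
        ext i
        by_cases hi : (i : E) ∈ J
        · simp only [x, hi, dite_true]
          rw [← hz]; rfl
        · have hie : i = ⟨e, Finset.mem_insert_self e J⟩ :=
            Subtype.ext ((Finset.mem_insert.mp i.2).resolve_right hi)
          simp only [x, hi, dite_false]
          rw [hie, hb]
      cases hb : z ⟨e, Finset.mem_insert_self e J⟩
      · exact Or.inl (hz' _ hb)
      · exact Or.inr (hz' _ hb)
    · rintro (rfl | rfl) <;> ext i <;> simp [x, Finset.restrict₂]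
  have hne : x false ≠ x true := by
    intro h
    have := congrFun h ⟨e, Finset.mem_insert_self e J⟩
    simp [x, he] at this
  rw [hpre, measure_union (by simpa using hne) (measurableSet_singleton _)]
  simp only [cylinderMeasure_singleton]
  rw [← ENNReal.ofReal_add (cylinderDet_nonneg hQ _ _) (cylinderDet_nonneg hQ _ _)]
  congr 1
  have heB : e ∉ boolSupport y := fun ⟨h, _⟩ => he h
  rw [← cylinderDet_add Q he heB]
  congr 1
  · refine cylinderDet_congr Q fun i hi => ?_
    rw [mem_boolSupport hi]
    by_cases hiJ : i ∈ J
    · simp [x, hiJ, mem_boolSupport hiJ]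
    · simp only [x, hiJ, dite_false, Bool.false_eq_true, iff_false]
      exact fun ⟨h, _⟩ => hiJ h
  · refine cylinderDet_congr Q fun i hi => ?_
    rw [mem_boolSupport hi]
    by_cases hiJ : i ∈ J
    · have : i ≠ e := fun h => he (h ▸ hiJ)
      simp [x, hiJ, mem_boolSupport hiJ, this]
    · have : i = e := (Finset.mem_insert.mp hi).resolve_right hiJ
      simp [x, this, he]

lemma isProjectiveMeasureFamily_cylinderMeasure {Q : Matrix E E ℂ} (hQ : IsPosContraction Q) :
    IsProjectiveMeasureFamily (α := fun _ : E => Bool) (cylinderMeasure Q) := by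
  have h : ∀ n : ℕ, ∀ I J : Finset E, ∀ hJI : J ⊆ I, (I \ J).card = n →
      cylinderMeasure Q J = (cylinderMeasure Q I).map (Finset.restrict₂ (π := fun _ => Bool) hJI) := by
    intro n
    induction n with
    | zero =>
      intro I J hJI hn
      have hIJ : I ⊆ J := Finset.sdiff_eq_empty_iff_subset.mp (Finset.card_eq_zero.mp hn)
      obtain rfl := Finset.Subset.antisymm hJI hIJ
      exact Measure.map_id.symm
    | succ n ih =>
      intro I J hJI hn
      obtain ⟨e, he⟩ : (I \ J).Nonempty := Finset.card_pos.mp (by omega)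
      rw [Finset.mem_sdiff] at he
      have hI : insert e (I.erase e) = I := Finset.insert_erase he.1
      have hJe : J ⊆ I.erase e := Finset.subset_erase.mpr ⟨hJI, he.2⟩
      have hcard : (I.erase e \ J).card = n := by
        rw [Finset.erase_sdiff_comm, Finset.card_erase_of_mem (Finset.mem_sdiff.mpr he), hn]
        rfl
      have heI : e ∉ I.erase e := Finset.notMem_erase e I
      generalize I.erase e = I' at *
      subst hI
      rw [ih I' J hJe hcard, cylinderMeasure_map_insert hQ heI,
        Measure.map_map (by fun_prop) (by fun_prop)]
      rfl
  exact fun I J hJI => h _ I J hJI rfl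

omit [DecidableEq E] in
/-- Every additive content on the cylinders of `E → Bool` is `σ`-subadditive, by compactness. -/
lemma isSigmaSubadditive_of_measurableCylinders
    (m : AddContent ENNReal (measurableCylinders fun _ : E => Bool)) : m.IsSigmaSubadditive := by
  have hclopen : ∀ s ∈ measurableCylinders fun _ : E => Bool, IsClopen s := by
    intro s hs
    obtain ⟨I, S, _, rfl⟩ := (mem_measurableCylinders s).mp hs
    have hcont : Continuous (I.restrict (π := fun _ : E => Bool)) := by fun_prop
    exact (isClopen_discrete S).preimage hcont
  intro f hf hU
  have hcomp : IsCompact (⋃ i, f i) := (hclopen _ hU).isClosed.isCompact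
  obtain ⟨t, ht⟩ := hcomp.elim_finite_subcover f (fun i => (hclopen _ (hf i)).isOpen) subset_rfl
  calc m (⋃ i, f i) = m (⋃ i ∈ t, f i) := by
        congr 1
        exact ht.antisymm (Set.iUnion₂_subset fun i _ => Set.subset_iUnion f i)
    _ ≤ ∑ i ∈ t, m (f i) :=
        addContent_biUnion_le isSetRing_measurableCylinders fun i _ => hf i
    _ ≤ ∑' i, m (f i) := ENNReal.sum_le_tsum t

/-- `P` assigns to every cylinder event the probability prescribed by the kernel `Q`. -/
def HasCylinderDet (P : Measure (Set E)) (Q : Matrix E E ℂ) : Prop :=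
  ∀ (F : Finset E) (B : Set E),
    P {S | ∀ i ∈ F, i ∈ S ↔ i ∈ B} = ENNReal.ofReal (cylinderDet Q F B)

omit [DecidableEq E] in
lemma measurableSet_agree (F : Finset E) (B : Set E) :
    MeasurableSet {S : Set E | ∀ i ∈ F, i ∈ S ↔ i ∈ B} := by
  have : {S : Set E | ∀ i ∈ F, i ∈ S ↔ i ∈ B} = ⋂ i ∈ F, {S | i ∈ S ↔ i ∈ B} := by
    ext; simp
  rw [this]
  refine Finset.measurableSet_biInter F fun i _ => ?_
  by_cases hi : i ∈ B
  · simpa [hi] using measurableSet_mem i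
  · simpa [hi] using measurableSet_notMem i

theorem exists_hasCylinderDet {Q : Matrix E E ℂ} (hQ : IsPosContraction Q) :
    ∃ P : Measure (Set E), HasCylinderDet P Q := by
  let m := projectiveFamilyContent (isProjectiveMeasureFamily_cylinderMeasure hQ)
  let μ : Measure (E → Bool) := m.measure isSetSemiring_measurableCylinders
    generateFrom_measurableCylinders.ge (isSigmaSubadditive_of_measurableCylinders m)
  let g : (E → Bool) → Set E := fun x => {e | x e = true}
  have hg : Measurable g := by
    refine measurable_set_iff.mpr fun a => ?_
    exact (Measurable.of_discrete (f := fun b : Bool => b = true)).comp (measurable_pi_apply a)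
  refine ⟨μ.map g, fun F B => ?_⟩
  classical
  rw [Measure.map_apply hg (measurableSet_agree F B)]
  let x : F → Bool := fun i => decide ((i : E) ∈ B)
  have hpre : g ⁻¹' {S | ∀ i ∈ F, i ∈ S ↔ i ∈ B} = cylinder (α := fun _ : E => Bool) F ({x} : Set (F → Bool)) := by
    ext z
    simp only [g, x, Set.mem_preimage, Set.mem_ofPred_eq, mem_cylinder, Set.mem_singleton_iff,
      funext_iff, Subtype.forall, Finset.restrict]
    refine forall₂_congr fun i _ => ?_
    by_cases hi : i ∈ B <;> simp [hi]
  have hmeas : MeasurableSet ({x} : Set (F → Bool)) := measurableSet_singleton x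
  rw [hpre, AddContent.measure_eq m _ generateFrom_measurableCylinders.symm _
    (cylinder_mem_measurableCylinders F _ hmeas),
    projectiveFamilyContent_cylinder _ hmeas, cylinderMeasure_singleton]
  congr 1
  refine cylinderDet_congr Q fun i hi => ?_
  rw [mem_boolSupport hi]
  simp [x]

lemma HasCylinderDet.isProbabilityMeasure {P : Measure (Set E)} {Q : Matrix E E ℂ}
    (hP : HasCylinderDet P Q) : IsProbabilityMeasure P := by
  refine ⟨?_⟩
  have := hP ∅ ∅
  simpa [cylinderDet_empty] using this

lemma HasCylinderDet.map_compl {P : Measure (Set E)} {Q : Matrix E E ℂ} (hP : HasCylinderDet P Q) :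
    HasCylinderDet (P.map compl) (1 - Q) := by
  intro F B
  rw [Measure.map_apply measurable_compl (measurableSet_agree F B), ← cylinderDet_compl, ← hP F Bᶜ]
  congr 1
  ext S
  simp only [Set.mem_preimage, Set.mem_ofPred_eq, Set.mem_compl_iff]
  exact forall₂_congr fun i _ => not_iff_comm.trans (by tauto)

lemma HasCylinderDet.isDeterminantal {P : Measure (Set E)} {Q : Matrix E E ℂ}
    (hP : HasCylinderDet P Q) (hQ : IsPosContraction Q) : IsDeterminantal P Q := by
  refine ⟨hP.isProbabilityMeasure, fun F => ?_⟩
  have h : {S : Set E | (F : Set E) ⊆ S} = {S | ∀ i ∈ F, i ∈ S ↔ i ∈ (F : Set E)} := by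
    ext S
    simp only [Set.mem_ofPred_eq, Set.subset_def, Finset.mem_coe]
    exact forall₂_congr fun i hi => by simp [hi]
  rw [h, measureReal_def, hP, ENNReal.toReal_ofReal (cylinderDet_nonneg hQ _ _),
    cylinderDet_self hQ]

/-- The inclusion events are stable under intersection and those of singletons already generate the
σ-field. -/
lemma IsDeterminantal.eq {P P' : Measure (Set E)} {Q : Matrix E E ℂ}
    (hP : IsDeterminantal P Q) (hP' : IsDeterminantal P' Q) : P' = P := by
  have := hP.isProbabilityMeasure
  have := hP'.isProbabilityMeasure
  let C : Set (Set (Set E)) := Set.range fun F : Finset E => {S | (F : Set E) ⊆ S}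
  have hgen : (Set.instMeasurableSpace : MeasurableSpace (Set E)) =
      MeasurableSpace.generateFrom C := by
    refine le_antisymm ?_ (MeasurableSpace.generateFrom_le ?_)
    · have h : @Measurable _ _ (MeasurableSpace.generateFrom C) Set.instMeasurableSpace
          (id : Set E → Set E) := by
        refine (@measurable_set_iff E (Set E) (MeasurableSpace.generateFrom C) id).mpr fun a => ?_
        refine (@measurableSet_setOfPred _ (MeasurableSpace.generateFrom C) _).mp ?_
        exact MeasurableSpace.measurableSet_generateFrom ⟨{a}, by simp⟩
      exact fun s hs => h hs
    · rintro _ ⟨F, rfl⟩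
      have : {S : Set E | (F : Set E) ⊆ S} = {S | ∀ i ∈ F, i ∈ S ↔ i ∈ (F : Set E)} := by
        ext S
        simp only [Set.mem_ofPred_eq, Set.subset_def, Finset.mem_coe]
        exact forall₂_congr fun i hi => by simp [hi]
      have hF := measurableSet_agree F (F : Set E)
      rwa [← this] at hF
  have hpi : IsPiSystem C := by
    rintro _ ⟨F, rfl⟩ _ ⟨G, rfl⟩ _
    refine ⟨F ∪ G, ?_⟩
    ext S
    simp
  refine ext_of_generate_finite C hgen hpi ?_ (by simp)
  rintro _ ⟨F, rfl⟩
  rw [← measureReal_eq_measureReal_iff]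
  have := (hP'.prob_subset F).trans (hP.prob_subset F).symm
  exact_mod_cast this

end Existence

/-! ### Toeplitz matrices as compressions of multiplication by an indicator. -/

section Fourier

open scoped ComplexOrder Matrix

lemma toeplitzMatrix_apply {A : Set UnitAddCircle} (hA : NullMeasurableSet A circleMeasure)
    (j k : ℤ) : toeplitzMatrix A j k = ∫ t in A, fourier (j - k) t ∂circleMeasure := by
  rw [toeplitzMatrix, Matrix.of_apply, fourierCoeff, ← integral_indicator₀ hA]
  refine integral_congr_ae (Filter.Eventually.of_forall fun t => ?_)
  by_cases ht : t ∈ A <;> simp [ht]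

lemma integrable_of_continuous_circle {f : UnitAddCircle → ℂ} (hf : Continuous f) :
    Integrable f circleMeasure :=
  hf.integrable_of_hasCompactSupport (HasCompactSupport.of_compactSpace f)

lemma toeplitzMatrix_self {A : Set UnitAddCircle} (hA : NullMeasurableSet A circleMeasure)
    (j : ℤ) : toeplitzMatrix A j j = circleMeasure.real A := by
  rw [toeplitzMatrix_apply hA]
  simp

lemma one_sub_toeplitzMatrix {A : Set UnitAddCircle} (hA : NullMeasurableSet A circleMeasure) :
    1 - toeplitzMatrix A = toeplitzMatrix Aᶜ := by
  ext j k
  have h1 : ∫ t, fourier (j - k) t ∂circleMeasure = (1 : Matrix ℤ ℤ ℂ) j k := by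
    have := fourierCoeff_fourier (T := (1 : ℝ)) (j - k)
    have h0 := congrFun this 0
    rw [fourierCoeff] at h0
    simp only [neg_zero, fourier_zero, one_smul] at h0
    rw [h0, Matrix.one_apply, Pi.single_apply]
    simp only [eq_comm, sub_eq_zero]
  rw [Matrix.sub_apply, toeplitzMatrix_apply hA, toeplitzMatrix_apply hA.compl, ← h1,
    ← integral_add_compl₀ hA (integrable_of_continuous_circle (by fun_prop)), add_sub_cancel_left]

/-- The form is the energy on `A` of a trigonometric polynomial, from which positivity is immediate.
-/
lemma toeplitzMatrix_form {A : Set UnitAddCircle} (hA : NullMeasurableSet A circleMeasure)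
    (F : Finset ℤ) (x : F → ℂ) :
    star x ⬝ᵥ principal (toeplitzMatrix A) F *ᵥ x =
      ((∫ t in A, ‖∑ k : F, star (x k) * fourier (k : ℤ) t‖ ^ 2 ∂circleMeasure : ℝ) : ℂ) := by
  have hint : ∀ j k : F, Integrable (fun t => star (x j) * (fourier ((j : ℤ) - k) t * x k))
      (circleMeasure.restrict A) := fun j k =>
    (integrable_of_continuous_circle (by fun_prop)).restrict
  rw [← integral_complex_ofReal]
  have hpt : ∀ t : UnitAddCircle,
      ((‖∑ k : F, star (x k) * fourier (k : ℤ) t‖ ^ 2 : ℝ) : ℂ) =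
        ∑ j : F, ∑ k : F, star (x j) * (fourier ((j : ℤ) - k) t * x k) := by
    intro t
    rw [← Complex.normSq_eq_norm_sq, ← Complex.mul_conj, map_sum, Finset.sum_mul_sum]
    refine Finset.sum_congr rfl fun j _ => Finset.sum_congr rfl fun k _ => ?_
    rw [map_mul, sub_eq_add_neg, fourier_add, fourier_neg, Complex.star_def,
      Complex.conj_conj]
    ring
  simp_rw [hpt]
  rw [integral_finsetSum _ fun j _ => integrable_finsetSum _ fun k _ => hint j k]
  refine Finset.sum_congr rfl fun j _ => ?_
  rw [integral_finsetSum _ fun k _ => hint j k, Matrix.mulVec, dotProduct, Finset.mul_sum]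
  refine Finset.sum_congr rfl fun k _ => ?_
  rw [integral_const_mul, integral_mul_const, ← toeplitzMatrix_apply hA]
  rfl

lemma toeplitzMatrix_isHermitian {A : Set UnitAddCircle} (hA : NullMeasurableSet A circleMeasure) :
    (toeplitzMatrix A).IsHermitian := by
  ext j k
  rw [Matrix.conjTranspose_apply, toeplitzMatrix_apply hA, toeplitzMatrix_apply hA,
    Complex.star_def, ← integral_conj]
  refine integral_congr_ae (Filter.Eventually.of_forall fun t => ?_)
  simp only
  rw [← fourier_neg, neg_sub]

lemma principal_toeplitzMatrix_posSemidef {A : Set UnitAddCircle}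
    (hA : NullMeasurableSet A circleMeasure) (F : Finset ℤ) :
    (principal (toeplitzMatrix A) F).PosSemidef := by
  refine Matrix.PosSemidef.of_dotProduct_mulVec_nonneg
    ((toeplitzMatrix_isHermitian hA).submatrix _) fun x => ?_
  rw [toeplitzMatrix_form hA, Complex.zero_le_real]
  positivity

lemma isPosContraction_toeplitzMatrix {A : Set UnitAddCircle}
    (hA : NullMeasurableSet A circleMeasure) : IsPosContraction (toeplitzMatrix A) :=
  ⟨principal_toeplitzMatrix_posSemidef hA, fun F => by
    rw [one_sub_toeplitzMatrix hA]; exact principal_toeplitzMatrix_posSemidef hA.compl F⟩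

lemma hasSum_sq_norm_fourierCoeff {f : UnitAddCircle → ℂ} (hf : MemLp f 2 circleMeasure) :
    HasSum (fun n => ‖fourierCoeff f n‖ ^ 2) (∫ t, ‖f t‖ ^ 2 ∂circleMeasure) := by
  have h := hasSum_sq_fourierCoeff (T := (1 : ℝ)) (hf.toLp f)
  have h1 : ∀ n, fourierCoeff (hf.toLp f) n = fourierCoeff f n := fun n =>
    congrFun (fourierCoeff_congr_ae hf.coeFn_toLp) n
  have h2 : ∫ t, ‖hf.toLp f t‖ ^ 2 ∂circleMeasure = ∫ t, ‖f t‖ ^ 2 ∂circleMeasure := by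
    refine integral_congr_ae ?_
    filter_upwards [hf.coeFn_toLp] with t ht
    rw [ht]
  simp only [h1] at h
  rwa [h2] at h

/-- A function supported in `A` whose Fourier coefficients vanish on `B` makes the projection to
`L²(A)` of trigonometric polynomials large. -/
lemma formDefect_toeplitzMatrix_le {A : Set UnitAddCircle}
    (hA : NullMeasurableSet A circleMeasure) {f : UnitAddCircle → ℂ}
    (hf : MemLp f 2 circleMeasure) (hfA : ∀ᵐ t ∂circleMeasure, t ∉ A → f t = 0)
    (F : Finset ℤ) {B : Set ℤ} (hB : ∀ k ∈ F, k ∈ B → fourierCoeff f k = 0)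
    (x : F → ℂ) (hx : ∀ i : F, (i : ℤ) ∉ B → x i = star (fourierCoeff f i)) :
    formDefect (principal (toeplitzMatrix A) F) (Subtype.val ⁻¹' B) x ≤
      (∫ t, ‖f t‖ ^ 2 ∂circleMeasure) - ∑ k ∈ F, ‖fourierCoeff f k‖ ^ 2 := by
  set K : ℝ := ∑ k ∈ F, ‖fourierCoeff f k‖ ^ 2 with hK
  let X : UnitAddCircle → ℂ := fun t => ∑ k : F, star (x k) * fourier (k : ℤ) t
  have hXc : Continuous X := by fun_prop
  have hfint : Integrable f circleMeasure := hf.integrable (by norm_num)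
  have hf2 : Integrable (fun t => ‖f t‖ ^ 2) circleMeasure := hf.integrable_norm_pow (by norm_num)
  have hX2 : Integrable (fun t => ‖X t‖ ^ 2) circleMeasure :=
    (hXc.norm.pow 2).integrable_of_hasCompactSupport (HasCompactSupport.of_compactSpace _)
  have hterm : ∀ k : F, Integrable (fun t => x k * (fourier (-(k : ℤ)) t • f t)) circleMeasure :=
    fun k => (hfint.fourier_smul _).const_mul _
  have hfX_eq : ∀ t, f t * star (X t) = ∑ k : F, x k * (fourier (-(k : ℤ)) t • f t) := by
    intro t
    simp only [X, star_sum, Finset.mul_sum, star_mul', star_star]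
    refine Finset.sum_congr rfl fun k _ => ?_
    rw [fourier_neg, smul_eq_mul, Complex.star_def]; ring
  have hfX : Integrable (fun t => f t * star (X t)) circleMeasure := by
    simp_rw [hfX_eq]
    exact integrable_finsetSum _ fun k _ => hterm k
  -- The free values of `x` on `B` meet vanishing coefficients of `f`, so the cross term is `K` for
  -- every admissible `x`.
  have hcross : ∫ t in A, f t * star (X t) ∂circleMeasure = (K : ℂ) := by
    rw [setIntegral_eq_integral_of_ae_compl_eq_zero]
    · simp_rw [hfX_eq]
      rw [integral_finsetSum _ fun k _ => hterm k, hK,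
        ← Finset.sum_coe_sort F (fun k => ‖fourierCoeff f k‖ ^ 2), Complex.ofReal_sum]
      refine Finset.sum_congr rfl fun k _ => ?_
      rw [integral_const_mul]
      change x k * fourierCoeff f k = _
      by_cases hk : (k : ℤ) ∈ B
      · simp [hB k k.2 hk]
      · rw [hx k hk, Complex.star_def, mul_comm, Complex.mul_conj, Complex.normSq_eq_norm_sq]
    · filter_upwards [hfA] with t ht hA
      rw [ht hA, zero_mul]
  have hfA2 : ∫ t in A, ‖f t‖ ^ 2 ∂circleMeasure = ∫ t, ‖f t‖ ^ 2 ∂circleMeasure := by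
    refine setIntegral_eq_integral_of_ae_compl_eq_zero ?_
    filter_upwards [hfA] with t ht hA
    simp [ht hA]
  have hsum : ∑ i, (Subtype.val ⁻¹' B : Set F)ᶜ.indicator (fun i => ‖x i‖ ^ 2) i = K := by
    rw [hK, ← Finset.sum_coe_sort F (fun k => ‖fourierCoeff f k‖ ^ 2)]
    refine Finset.sum_congr rfl fun k _ => ?_
    by_cases hk : (k : ℤ) ∈ B
    · simp [hk, hB k k.2 hk]
    · simp [hk, hx k hk]
  -- The integrand is `‖X - f‖²`; expanding it bounds the energy of `X` on `A` below by `2K - ‖f‖²`.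
  have hpos : 0 ≤ ∫ t in A, (‖X t‖ ^ 2 - 2 * (f t * star (X t)).re + ‖f t‖ ^ 2) ∂circleMeasure := by
    refine integral_nonneg fun t => ?_
    have : ‖X t‖ ^ 2 - 2 * (f t * star (X t)).re + ‖f t‖ ^ 2 = ‖X t - f t‖ ^ 2 := by
      simp only [← Complex.normSq_eq_norm_sq, Complex.normSq_apply, Complex.star_def]
      simp; ring
    rw [this]; positivity
  have hre : ∫ t in A, (f t * star (X t)).re ∂circleMeasure = K := by
    have := integral_re (𝕜 := ℂ) (hfX.restrict (s := A))
    simp only [RCLike.re_eq_complex_re] at this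
    rw [this, hcross, Complex.ofReal_re]
  have hfXre : Integrable (fun t => 2 * (f t * star (X t)).re) circleMeasure :=
    hfX.re.const_mul 2
  have hX2A : Integrable (fun t => ‖X t‖ ^ 2) (circleMeasure.restrict A) := hX2.restrict
  have hfXA := hfXre.restrict (s := A)
  have hf2A := hf2.restrict (s := A)
  have hsubA : Integrable (fun t => ‖X t‖ ^ 2 - 2 * (f t * star (X t)).re)
      (circleMeasure.restrict A) := hX2A.sub hfXA
  rw [integral_add hsubA hf2A, integral_sub hX2A hfXA, integral_const_mul, hfA2] at hpos
  rw [hre] at hpos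
  rw [formDefect, hsum, toeplitzMatrix_form hA, Complex.ofReal_re]
  change K - ∫ t in A, ‖X t‖ ^ 2 ∂circleMeasure ≤ _
  linarith

end Fourier

/-! ### Almost sure completeness of the random characters in `L²(A)`. -/

section Completeness

/-- Square-integrable functions supported in `A` whose Fourier coefficient at `e` is `1`, whose
Fourier coefficients on `F ∩ B` vanish and whose energy off `insert e F` is at most `ε`. -/
structure IsConcentrated (A : Set UnitAddCircle) (F : Finset ℤ) (e : ℤ) (ε : ℝ) (B : Set ℤ)
    (f : UnitAddCircle → ℂ) : Prop where
  memLp : MemLp f 2 circleMeasure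
  supported : ∀ᵐ t ∂circleMeasure, t ∉ A → f t = 0
  coeff_eq_zero : ∀ k ∈ F, k ∈ B → fourierCoeff f k = 0
  coeff_eq_one : fourierCoeff f e = 1
  energy_le : (∫ t, ‖f t‖ ^ 2 ∂circleMeasure) - ∑ k ∈ insert e F, ‖fourierCoeff f k‖ ^ 2 ≤ ε

variable {A : Set UnitAddCircle} {P : Measure (Set ℤ)}

lemma IsConcentrated.cylinderDet_le (hA : NullMeasurableSet A circleMeasure) {F : Finset ℤ} {e : ℤ}
    (he : e ∉ F) {ε : ℝ} {B : Set ℤ} (heB : e ∉ B) {f : UnitAddCircle → ℂ}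
    (hf : IsConcentrated A F e ε B f) :
    cylinderDet (toeplitzMatrix A) (insert e F) B ≤ ε * cylinderDet (toeplitzMatrix A) F B := by
  refine cylinderDet_insert_le (isPosContraction_toeplitzMatrix hA) he heB
    (u := fun k => star (fourierCoeff f k)) (by simp [hf.coeff_eq_one]) fun x hx => ?_
  refine (formDefect_toeplitzMatrix_le hA hf.memLp hf.supported _ ?_ x hx).trans hf.energy_le
  intro k hk hkB
  rcases Finset.mem_insert.mp hk with rfl | hk
  · exact absurd hkB heB
  · exact hf.coeff_eq_zero k hk hkB

lemma HasCylinderDet.sum_powerset_le (hP : HasCylinderDet P (toeplitzMatrix A)) (F : Finset ℤ) :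
    ∑ B ∈ F.powerset, ENNReal.ofReal (cylinderDet (toeplitzMatrix A) F B) ≤ 1 := by
  have := hP.isProbabilityMeasure
  have h : ∑ B ∈ F.powerset, ENNReal.ofReal (cylinderDet (toeplitzMatrix A) F B) =
      P (⋃ B ∈ F.powerset, {S | ∀ i ∈ F, i ∈ S ↔ i ∈ (B : Set ℤ)}) := by
    rw [measure_biUnion_finset]
    · exact Finset.sum_congr rfl fun B _ => (hP F B).symm
    · intro B hB C hC hBC
      refine Set.disjoint_left.mpr fun S hS hS' => hBC ?_
      rw [Finset.coe_powerset, Set.mem_preimage, Set.mem_powerset_iff, Finset.coe_subset] at hB hC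
      ext i
      constructor
      · intro hi
        exact (hS' i (hB hi)).mp ((hS i (hB hi)).mpr hi)
      · intro hi
        exact (hS i (hC hi)).mp ((hS' i (hC hi)).mpr hi)
    · exact fun B _ => measurableSet_agree F B
  rw [h]
  exact prob_le_one

/-- Only the pattern `B = S ∩ F` matters for the existence of `f`; each admissible pattern costs at
most `ε` times its own probability, and these probabilities sum to at most `1`. -/
lemma HasCylinderDet.measure_concentrated_le (hA : NullMeasurableSet A circleMeasure)
    (hP : HasCylinderDet P (toeplitzMatrix A)) {F : Finset ℤ} {e : ℤ} (he : e ∉ F) (ε : ℝ) :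
    P {S | e ∉ S ∧ ∃ f, IsConcentrated A F e ε S f} ≤ ENNReal.ofReal ε := by
  classical
  let G : Finset (Finset ℤ) := F.powerset.filter fun B => ∃ f, IsConcentrated A F e ε B f
  have hsub : {S | e ∉ S ∧ ∃ f, IsConcentrated A F e ε S f} ⊆
      ⋃ B ∈ G, {S | ∀ i ∈ insert e F, i ∈ S ↔ i ∈ (B : Set ℤ)} := by
    rintro S ⟨heS, f, hf⟩
    have hmem : F.filter (· ∈ S) ∈ G := by
      refine Finset.mem_filter.mpr ⟨Finset.mem_powerset.mpr (Finset.filter_subset _ _), f, ?_⟩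
      refine ⟨hf.memLp, hf.supported, fun k hk hkS => ?_, hf.coeff_eq_one, hf.energy_le⟩
      exact hf.coeff_eq_zero k hk (Finset.mem_filter.mp hkS).2
    refine Set.mem_biUnion hmem fun i hi => ?_
    rcases Finset.mem_insert.mp hi with rfl | hi
    · simp [heS]
    · simp [hi]
  calc P {S | e ∉ S ∧ ∃ f, IsConcentrated A F e ε S f}
      ≤ P (⋃ B ∈ G, {S | ∀ i ∈ insert e F, i ∈ S ↔ i ∈ (B : Set ℤ)}) := measure_mono hsub
    _ ≤ ∑ B ∈ G, P {S | ∀ i ∈ insert e F, i ∈ S ↔ i ∈ (B : Set ℤ)} :=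
        measure_biUnion_finset_le _ _
    _ ≤ ∑ B ∈ G, ENNReal.ofReal ε * ENNReal.ofReal (cylinderDet (toeplitzMatrix A) F B) := by
        refine Finset.sum_le_sum fun B hB => ?_
        obtain ⟨hBF, f, hf⟩ := Finset.mem_filter.mp hB
        have heB : e ∉ (B : Set ℤ) := fun h => he (Finset.mem_powerset.mp hBF h)
        rw [hP, ← ENNReal.ofReal_mul' (cylinderDet_nonneg (isPosContraction_toeplitzMatrix hA) _ _)]
        exact ENNReal.ofReal_le_ofReal (hf.cylinderDet_le hA he heB)
    _ ≤ ∑ B ∈ F.powerset,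
          ENNReal.ofReal ε * ENNReal.ofReal (cylinderDet (toeplitzMatrix A) F B) :=
        Finset.sum_le_sum_of_subset (Finset.filter_subset _ _)
    _ = ENNReal.ofReal ε * ∑ B ∈ F.powerset,
          ENNReal.ofReal (cylinderDet (toeplitzMatrix A) F B) := by rw [Finset.mul_sum]
    _ ≤ ENNReal.ofReal ε := mul_le_of_le_one_right' (hP.sum_powerset_le F)

-- By Parseval, a given `f` is `ε`-concentrated for all large `n`. The sets `V n` need not be
-- measurable: continuity from below along increasing sets holds without it.
open Filter Topology in
lemma HasCylinderDet.measure_coeff_eq_one (hA : NullMeasurableSet A circleMeasure)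
    (hP : HasCylinderDet P (toeplitzMatrix A)) (e : ℤ) :
    P {S | e ∉ S ∧ ∃ f : UnitAddCircle → ℂ, MemLp f 2 circleMeasure ∧ (∀ᵐ t ∂circleMeasure, t ∉ A → f t = 0) ∧
      (∀ k ∈ S, fourierCoeff f k = 0) ∧ fourierCoeff f e = 1} = 0 := by
  let F : ℕ → Finset ℤ := fun n => (Finset.Icc (-n : ℤ) n).erase e
  have he : ∀ n, e ∉ F n := fun n => Finset.notMem_erase e _
  have hF : Tendsto (fun n => insert e (F n)) atTop atTop := by
    refine tendsto_atTop_finset_of_monotone ?_ ?_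
    · intro m n hmn k hk
      simp only [F, Finset.mem_insert, Finset.mem_erase, Finset.mem_Icc] at hk ⊢
      omega
    · intro k
      refine ⟨k.natAbs, ?_⟩
      simp only [F, Finset.mem_insert, Finset.mem_erase, Finset.mem_Icc]
      omega
  refine le_antisymm (ENNReal.le_of_forall_pos_le_add fun ε hε _ => ?_) (zero_le)
  let V : ℕ → Set (Set ℤ) := fun n => {S | e ∉ S ∧ ∃ f, IsConcentrated A (F n) e ε S f}
  have hsub : {S | e ∉ S ∧ ∃ f : UnitAddCircle → ℂ, MemLp f 2 circleMeasure ∧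
      (∀ᵐ t ∂circleMeasure, t ∉ A → f t = 0) ∧
      (∀ k ∈ S, fourierCoeff f k = 0) ∧ fourierCoeff f e = 1} ⊆ ⋃ N, ⋂ n ≥ N, V n := by
    rintro S ⟨heS, f, hf, hfA, hS, hfe⟩
    have ht : Tendsto (fun n => (∫ t, ‖f t‖ ^ 2 ∂circleMeasure) -
        ∑ k ∈ insert e (F n), ‖fourierCoeff f k‖ ^ 2) atTop (𝓝 0) := by
      have := ((hasSum_sq_norm_fourierCoeff hf).comp hF).const_sub
        (∫ t, ‖f t‖ ^ 2 ∂circleMeasure)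
      rwa [sub_self] at this
    obtain ⟨N, hN⟩ := eventually_atTop.mp (ht.eventually (ge_mem_nhds (show (0 : ℝ) < ε from hε)))
    refine Set.mem_iUnion.mpr ⟨N, Set.mem_iInter₂.mpr fun n hn => ⟨heS, f, ?_⟩⟩
    exact ⟨hf, hfA, fun k _ hk => hS k hk, hfe, hN n hn⟩
  have hmono : Monotone fun N => ⋂ n ≥ N, V n := fun M N hMN =>
    Set.biInter_subset_biInter_left fun n (hn : N ≤ n) => hMN.trans hn
  refine (measure_mono hsub).trans ?_
  rw [hmono.measure_iUnion, zero_add]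
  refine iSup_le fun N => (measure_mono (Set.biInter_subset_of_mem (le_refl N))).trans ?_
  exact (hP.measure_concentrated_le hA (he N) ε).trans (by simp)

lemma ae_eq_zero_of_fourierCoeff_eq_zero {f : UnitAddCircle → ℂ} (hf : MemLp f 2 circleMeasure)
    (h : ∀ n, fourierCoeff f n = 0) : f =ᵐ[circleMeasure] 0 := by
  have h1 := hasSum_sq_norm_fourierCoeff hf
  simp only [h, norm_zero, ne_eq, OfNat.ofNat_ne_zero, not_false_eq_true, zero_pow] at h1
  have h2 := h1.unique hasSum_zero
  rw [integral_eq_zero_iff_of_nonneg (fun t => by positivity)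
    (hf.integrable_norm_pow (by norm_num))] at h2
  filter_upwards [h2] with t ht
  simpa using ht

/-- Almost surely, the projections to `L²(A)` of the characters in `S` are complete. -/
theorem HasCylinderDet.ae_isUniquenessSet_compl (hA : NullMeasurableSet A circleMeasure)
    (hP : HasCylinderDet P (toeplitzMatrix A)) : ∀ᵐ S ∂P, IsUniquenessSet Aᶜ Sᶜ := by
  have hae : ∀ᵐ S ∂P, ∀ e : ℤ, ¬ (e ∉ S ∧ ∃ f : UnitAddCircle → ℂ, MemLp f 2 circleMeasure ∧
      (∀ᵐ t ∂circleMeasure, t ∉ A → f t = 0) ∧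
      (∀ k ∈ S, fourierCoeff f k = 0) ∧ fourierCoeff f e = 1) := by
    refine ae_all_iff.mpr fun e => ?_
    rw [ae_iff]
    simp only [not_not]
    exact hP.measure_coeff_eq_one hA e
  filter_upwards [hae] with S hS f hf hfA hfS
  refine ae_eq_zero_of_fourierCoeff_eq_zero hf fun e => ?_
  by_cases heS : e ∈ S
  · exact hfS e (fun h => h heS)
  by_contra hne
  refine hS e ⟨heS, (fun t => (fourierCoeff f e)⁻¹ * f t), hf.const_mul _, ?_, ?_, ?_⟩
  · filter_upwards [hfA] with t ht htA
    rw [ht htA, mul_zero]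
  · intro k hk
    rw [fourierCoeff.const_mul, hfS k (fun h => h hk), mul_zero]
  · rw [fourierCoeff.const_mul, inv_mul_cancel₀ hne]

end Completeness

/-! ### A Chernoff bound from inclusion probabilities. -/

section LargeDeviations

variable {E : Type*} {P : Measure (Set E)}

lemma measurableSet_superset (F : Finset E) : MeasurableSet {S : Set E | (F : Set E) ⊆ S} := by
  have : {S : Set E | (F : Set E) ⊆ S} = ⋂ i ∈ F, {S | i ∈ S} := by
    ext S; simp [Set.subset_def]
  rw [this]
  exact Finset.measurableSet_biInter F fun i _ => measurableSet_mem i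

/-- Expanding the product of `1 + t·𝟙[i ∈ S]` over `i ∈ I` reduces exponential moments to inclusion
probabilities. -/
lemma one_add_pow_ncard (S : Set E) (I : Finset E) (t : ℝ) :
    (1 + t) ^ (S ∩ I).ncard =
      ∑ F ∈ I.powerset, {S : Set E | (F : Set E) ⊆ S}.indicator (fun _ => t ^ F.card) S := by
  classical
  have hcard : (S ∩ I).ncard = (I.filter (· ∈ S)).card := by
    rw [← Set.ncard_coe_finset]
    congr 1
    ext i; simp [and_comm]
  have h1 : ∏ i ∈ I, (1 + if i ∈ S then t else 0) = (1 + t) ^ (S ∩ I).ncard := by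
    rw [hcard, ← Finset.prod_const, Finset.prod_filter]
    refine Finset.prod_congr rfl fun i _ => ?_
    by_cases hi : i ∈ S <;> simp [hi]
  rw [← h1, Finset.prod_one_add]
  refine Finset.sum_congr rfl fun F _ => ?_
  by_cases hF : (F : Set E) ⊆ S
  · rw [Set.indicator_of_mem (by exact hF), ← Finset.prod_const]
    exact Finset.prod_congr rfl fun i hi => if_pos (hF hi)
  · rw [Set.indicator_of_notMem (by exact hF)]
    obtain ⟨i, hi, hiS⟩ := Set.not_subset.mp hF
    exact Finset.prod_eq_zero (i := i) hi (if_neg hiS)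

lemma lintegral_one_add_pow_ncard_le {a : ℝ}
    (hP : ∀ F : Finset E, P {S | (F : Set E) ⊆ S} ≤ ENNReal.ofReal (a ^ F.card)) (ha : 0 ≤ a)
    (I : Finset E) {t : ℝ} (ht : 0 ≤ t) :
    ∫⁻ S, ENNReal.ofReal ((1 + t) ^ (S ∩ I).ncard) ∂P ≤
      ENNReal.ofReal ((1 + t * a) ^ I.card) := by
  have hnn : ∀ (F : Finset E) (S : Set E),
      0 ≤ {S : Set E | (F : Set E) ⊆ S}.indicator (fun _ => t ^ F.card) S := fun F S =>
    Set.indicator_nonneg (fun _ _ => pow_nonneg ht _) S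
  simp_rw [one_add_pow_ncard, ENNReal.ofReal_sum_of_nonneg fun F _ => hnn F _]
  rw [lintegral_finsetSum]
  · have hterm : ∀ F ∈ I.powerset,
        ∫⁻ S, ENNReal.ofReal ({S : Set E | (F : Set E) ⊆ S}.indicator (fun _ => t ^ F.card) S) ∂P ≤
          ENNReal.ofReal ((t * a) ^ F.card) := by
      intro F _
      have h : ∀ S, ENNReal.ofReal
          ({S : Set E | (F : Set E) ⊆ S}.indicator (fun _ => t ^ F.card) S) =
          {S : Set E | (F : Set E) ⊆ S}.indicator (fun _ => ENNReal.ofReal (t ^ F.card)) S := by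
        intro S
        by_cases hF : (F : Set E) ⊆ S <;> simp [hF]
      simp_rw [h]
      rw [lintegral_indicator_const (measurableSet_superset F), mul_pow,
        ENNReal.ofReal_mul (pow_nonneg ht _)]
      gcongr
      exact hP F
    refine (Finset.sum_le_sum hterm).trans (le_of_eq ?_)
    rw [← ENNReal.ofReal_sum_of_nonneg fun F _ => by positivity, ← Finset.prod_const,
      Finset.prod_one_add]
    simp only [Finset.prod_const]
  · intro F _
    exact (measurable_const.indicator (measurableSet_superset F)).ennreal_ofReal

/-- Exponential decay of the probability that a random set has too many elements. -/
theorem exists_measure_density_ge_le {a : ℝ}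
    (hP : ∀ F : Finset E, P {S | (F : Set E) ⊆ S} ≤ ENNReal.ofReal (a ^ F.card)) (ha : 0 ≤ a)
    {D : ℝ} (hD : a < D) :
    ∃ ρ : ℝ, 0 < ρ ∧ ρ < 1 ∧ ∀ I : Finset E,
      P {S | D * I.card ≤ ((S ∩ I).ncard : ℝ)} ≤ ENNReal.ofReal (ρ ^ I.card) := by
  -- Small enough for `a * (1 + t) < D`, which makes the exponent defining `ρ` negative.
  set t : ℝ := (D - a) / (2 * (a + 1)) with ht_def
  have ht : 0 < t := by have := sub_pos.mpr hD; positivity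
  have hta : a * (1 + t) < D := by
    have h1 : t * (2 * (a + 1)) = D - a := by rw [ht_def]; field_simp
    nlinarith
  refine ⟨Real.exp (t * a - D * (t / (1 + t))), Real.exp_pos _, ?_, fun I => ?_⟩
  · rw [Real.exp_lt_one_iff, sub_neg, mul_div_assoc', lt_div_iff₀ (by positivity)]
    nlinarith
  set c : ℝ := Real.exp (D * (t / (1 + t)) * I.card) with hc
  have hsub : {S : Set E | D * I.card ≤ ((S ∩ I).ncard : ℝ)} ⊆
      {S | ENNReal.ofReal c ≤ ENNReal.ofReal ((1 + t) ^ (S ∩ I).ncard)} := by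
    intro S hS
    refine ENNReal.ofReal_le_ofReal ?_
    rw [← Real.exp_log (by positivity : 0 < 1 + t), ← Real.exp_nat_mul, hc]
    refine Real.exp_le_exp.mpr ?_
    have hlog : t / (1 + t) ≤ Real.log (1 + t) := by
      have := Real.one_sub_inv_le_log_of_pos (by positivity : 0 < 1 + t)
      have h2 : t / (1 + t) = 1 - (1 + t)⁻¹ := by field_simp; ring
      rwa [h2]
    have hS' : D * I.card ≤ ((S ∩ I).ncard : ℝ) := hS
    calc D * (t / (1 + t)) * I.card = (D * I.card) * (t / (1 + t)) := by ring
      _ ≤ ((S ∩ I).ncard : ℝ) * (t / (1 + t)) := by gcongr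
      _ ≤ ((S ∩ I).ncard : ℝ) * Real.log (1 + t) := by gcongr
  have hmeas : Measurable fun S : Set E => ENNReal.ofReal ((1 + t) ^ (S ∩ I).ncard) := by
    simp_rw [one_add_pow_ncard]
    refine (Finset.measurable_sum _ fun F _ => ?_).ennreal_ofReal
    exact measurable_const.indicator (measurableSet_superset F)
  have hmarkov := mul_meas_ge_le_lintegral (μ := P) hmeas (ENNReal.ofReal c)
  have hle := hmarkov.trans (lintegral_one_add_pow_ncard_le hP ha I ht.le)
  have hc0 : ENNReal.ofReal c ≠ 0 := (ENNReal.ofReal_pos.mpr (Real.exp_pos _)).ne'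
  refine (measure_mono hsub).trans ?_
  rw [mul_comm, ← ENNReal.le_div_iff_mul_le (Or.inl hc0) (Or.inl ENNReal.ofReal_ne_top),
    ← ENNReal.ofReal_div_of_pos (Real.exp_pos _)] at hle
  refine hle.trans (ENNReal.ofReal_le_ofReal ?_)
  rw [div_le_iff₀ (Real.exp_pos _), ← Real.exp_nat_mul, ← Real.exp_add]
  have h1 : (1 + t * a) ^ I.card ≤ Real.exp (t * a) ^ I.card := by
    have := Real.add_one_le_exp (t * a)
    gcongr
    linarith
  rw [← Real.exp_nat_mul] at h1
  refine h1.trans (le_of_eq ?_)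
  congr 1
  ring

end LargeDeviations

/-! ### Beurling–Malliavin density via Borel–Cantelli. -/

section Density

lemma HasSubstantialIntervals.mono {S : Set ℤ} {D D' : ℝ} (h : HasSubstantialIntervals S D)
    (hD : D' ≤ D) : HasSubstantialIntervals S D' := by
  obtain ⟨a, b, h1, h2, h3, h4, h5⟩ := h
  refine ⟨a, b, h1, h2, h3, fun n => le_trans ?_ (h4 n), h5⟩
  gcongr

/-- Here `m` is the distance from the interval to `0`. -/
lemma aspect_sub_one {a b : ℤ} (hab : a ≤ b) (h0 : (0 : ℤ) ∉ Set.Icc a b) :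
    ∃ m : ℝ, 1 ≤ m ∧ |(a : ℝ)| ≤ m + (b - a) ∧ aspect a b - 1 = (b - a) / m := by
  have hab' : (a : ℝ) ≤ b := by exact_mod_cast hab
  rw [Set.mem_Icc, not_and_or, not_le, not_le] at h0
  rcases h0 with h0 | h0
  · have ha : (1 : ℝ) ≤ a := by exact_mod_cast h0
    refine ⟨a, ha, ?_, ?_⟩
    · rw [abs_of_pos (by linarith)]; linarith
    · rw [aspect, abs_of_pos (by linarith), abs_of_pos (by linarith), max_eq_right hab',
        min_eq_left hab']
      field_simp
  · have hb : (b : ℝ) ≤ -1 := by exact_mod_cast (by omega : b ≤ -1)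
    refine ⟨-b, by linarith, ?_, ?_⟩
    · rw [abs_of_neg (by linarith)]; linarith
    · have hb0 : (-b : ℝ) ≠ 0 := by linarith
      rw [aspect, abs_of_neg (by linarith), abs_of_neg (by linarith), max_eq_left (by linarith),
        min_eq_right (by linarith), div_sub_one hb0]
      ring

/-- With `ℓ = b - a`, a short interval has `|a| ≤ (L + 1) m`; a distant one has `|a| ≤ 2m` and `ℓ² ≤
√|a|`. The exponent `-3/2` is summable over the integers. -/
lemma aspect_sub_one_sq_le {a b : ℤ} (hab : a ≤ b) (h0 : (0 : ℤ) ∉ Set.Icc a b) {L : ℝ}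
    (hL : 0 ≤ L) (h : (b - a : ℝ) ≤ L ∨ 2 * ((b - a : ℝ) + 1) ^ 4 ≤ |(a : ℝ)|) :
    (aspect a b - 1) ^ 2 ≤ (L ^ 2 * (L + 1) ^ 2 + 4) * |(a : ℝ)| ^ (-(3 / 2) : ℝ) := by
  obtain ⟨m, hm, ham, hasp⟩ := aspect_sub_one hab h0
  have hab' : (a : ℝ) ≤ b := by exact_mod_cast hab
  set ℓ : ℝ := b - a with hℓ
  have hℓ0 : 0 ≤ ℓ := by simp only [hℓ]; linarith
  have ha1 : 1 ≤ |(a : ℝ)| := by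
    have : a ≠ 0 := fun h => h0 ⟨h.le, h ▸ hab⟩
    exact_mod_cast Int.one_le_abs this
  set x : ℝ := |(a : ℝ)| with hx
  have hx0 : 0 < x := by linarith
  have hpow : x ^ (-(3 / 2) : ℝ) = Real.sqrt x / x ^ 2 := by
    rw [Real.sqrt_eq_rpow, ← Real.rpow_natCast x 2, ← Real.rpow_sub hx0]
    norm_num
  have hsq1 : 1 ≤ Real.sqrt x := Real.one_le_sqrt.mpr ha1
  rw [hasp, hpow, div_pow, mul_div_assoc', div_le_div_iff₀ (by positivity) (by positivity)]
  rcases h with h | h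
  · have hxm : x ≤ (L + 1) * m := by nlinarith
    calc ℓ ^ 2 * x ^ 2 ≤ L ^ 2 * ((L + 1) * m) ^ 2 := by gcongr
      _ = L ^ 2 * (L + 1) ^ 2 * 1 * m ^ 2 := by ring
      _ ≤ (L ^ 2 * (L + 1) ^ 2 + 4) * Real.sqrt x * m ^ 2 := by
        gcongr; linarith
  · have hℓ4 : 2 * ℓ ≤ x := by
      have : 1 + (4 : ℕ) * ℓ ≤ (1 + ℓ) ^ 4 := one_add_mul_le_pow (by linarith) 4
      push_cast at this
      have h2 : (1 + ℓ) ^ 4 = (ℓ + 1) ^ 4 := by ring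
      linarith
    have hxm : x ≤ 2 * m := by linarith
    have hℓs : ℓ ^ 2 ≤ Real.sqrt x := by
      refine Real.le_sqrt_of_sq_le ?_
      have : ℓ ^ 4 ≤ (ℓ + 1) ^ 4 := by gcongr; linarith
      nlinarith [pow_nonneg hℓ0 4]
    calc ℓ ^ 2 * x ^ 2 ≤ Real.sqrt x * (2 * m) ^ 2 := by gcongr
      _ = 4 * Real.sqrt x * m ^ 2 := by ring
      _ ≤ (L ^ 2 * (L + 1) ^ 2 + 4) * Real.sqrt x * m ^ 2 := by
        gcongr; nlinarith [sq_nonneg L, sq_nonneg (L + 1), mul_nonneg (sq_nonneg L) (sq_nonneg (L + 1))]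

/-- Disjoint intervals have distinct left ends, so the sum is dominated by one over all integers. -/
lemma tsum_aspect_ne_top {a b : ℕ → ℤ} (hab : ∀ n, a n ≤ b n)
    (h0 : ∀ n, (0 : ℤ) ∉ Set.Icc (a n) (b n))
    (hdisj : Pairwise fun m n => Disjoint (Set.Icc (a m) (b m)) (Set.Icc (a n) (b n)))
    {L : ℝ} (hL : 0 ≤ L)
    (h : ∀ n, (b n - a n : ℝ) ≤ L ∨ 2 * ((b n - a n : ℝ) + 1) ^ 4 ≤ |(a n : ℝ)|) :
    ∑' n, ENNReal.ofReal ((aspect (a n) (b n) - 1) ^ 2) ≠ ⊤ := by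
  have hinj : Function.Injective a := by
    intro m n hmn
    by_contra hne
    refine Set.disjoint_left.mp (hdisj hne) (Set.left_mem_Icc.mpr (hab m)) ?_
    rw [hmn]
    exact Set.left_mem_Icc.mpr (hab n)
  let c : ℤ → ℝ := fun k => (L ^ 2 * (L + 1) ^ 2 + 4) * |(k : ℝ)| ^ (-(3 / 2) : ℝ)
  have hc : Summable c := (Real.summable_abs_int_rpow (by norm_num)).mul_left _
  refine ne_top_of_le_ne_top hc.tsum_ofReal_ne_top ?_
  calc ∑' n, ENNReal.ofReal ((aspect (a n) (b n) - 1) ^ 2)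
      ≤ ∑' n, ENNReal.ofReal (c (a n)) := ENNReal.tsum_le_tsum fun n =>
        ENNReal.ofReal_le_ofReal (aspect_sub_one_sq_le (hab n) (h0 n) hL (h n))
    _ ≤ ∑' k, ENNReal.ofReal (c k) :=
        ENNReal.tsum_comp_le_tsum_of_injective hinj fun k => ENNReal.ofReal (c k)

variable {P : Measure (Set ℤ)} {a : ℝ}

theorem ae_not_hasSubstantialIntervals
    (hP : ∀ F : Finset ℤ, P {S | (F : Set ℤ) ⊆ S} ≤ ENNReal.ofReal (a ^ F.card)) (ha : 0 ≤ a)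
    {D : ℝ} (hD : a < D) : ∀ᵐ S ∂P, ¬ HasSubstantialIntervals S D := by
  obtain ⟨ρ, hρ0, hρ1, hρ⟩ := exists_measure_density_ge_le hP ha hD
  -- For intervals of `l + 1` points, only polynomially many left ends are near enough to matter,
  -- too few to offset the decay of `ρ ^ (l + 1)`.
  let R : ℕ → Finset ℤ := fun l => Finset.Icc (-(2 * (l + 1) ^ 4)) (2 * (l + 1) ^ 4)
  let G : ℕ → Set (Set ℤ) := fun l => ⋃ k ∈ R l,
    {S | D * (Finset.Icc k (k + l)).card ≤ ((S ∩ (Finset.Icc k (k + l) : Finset ℤ)).ncard : ℝ)}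
  have hG : ∀ l, P (G l) ≤ ENNReal.ofReal (5 * (((l + 1 : ℕ) : ℝ) ^ 4 * ρ ^ (l + 1))) := by
    intro l
    have hcard : ∀ k : ℤ, (Finset.Icc k (k + l)).card = l + 1 := by
      intro k; rw [Int.card_Icc]; omega
    have hR : ((R l).card : ℝ) ≤ 5 * ((l + 1 : ℕ) : ℝ) ^ 4 := by
      have h1 : (R l).card = 4 * (l + 1) ^ 4 + 1 := by
        simp only [R, Int.card_Icc]
        have : (2 * ((l : ℤ) + 1) ^ 4 + 1 - -(2 * ((l : ℤ) + 1) ^ 4)) =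
            ((4 * (l + 1) ^ 4 + 1 : ℕ) : ℤ) := by push_cast; ring
        rw [this, Int.toNat_natCast]
      have h2 : 1 ≤ (l + 1) ^ 4 := Nat.one_le_pow _ _ (Nat.succ_pos l)
      rw [h1]
      exact_mod_cast (by omega : 4 * (l + 1) ^ 4 + 1 ≤ 5 * (l + 1) ^ 4)
    calc P (G l) ≤ ∑ k ∈ R l, ENNReal.ofReal (ρ ^ (l + 1)) := by
          refine (measure_biUnion_finset_le _ _).trans (Finset.sum_le_sum fun k _ => ?_)
          have := hρ (Finset.Icc k (k + l))
          rwa [hcard k] at this ⊢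
      _ = ENNReal.ofReal ((R l).card * ρ ^ (l + 1)) := by
          rw [Finset.sum_const, nsmul_eq_mul, ENNReal.ofReal_mul (by positivity),
            ENNReal.ofReal_natCast]
      _ ≤ _ := by
          refine ENNReal.ofReal_le_ofReal ?_
          rw [← mul_assoc]
          gcongr
  have hsum : Summable fun l : ℕ => 5 * (((l + 1 : ℕ) : ℝ) ^ 4 * ρ ^ (l + 1)) := by
    refine Summable.mul_left 5 ?_
    exact (summable_nat_add_iff (f := fun n : ℕ => (n : ℝ) ^ 4 * ρ ^ n) 1).mpr
      (summable_pow_mul_geometric_of_norm_lt_one 4 (by rwa [Real.norm_of_nonneg hρ0.le]))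
  have hfin : ∑' l, P (G l) ≠ ⊤ :=
    ne_top_of_le_ne_top hsum.tsum_ofReal_ne_top (ENNReal.tsum_le_tsum hG)
  filter_upwards [ae_eventually_notMem hfin] with S hS ⟨a', b', h1, h2, h3, h4, h5⟩
  obtain ⟨N, hN⟩ := Filter.eventually_atTop.mp hS
  -- The Borel–Cantelli threshold `N` acts as the length bound: a longer dense interval with a
  -- nearby left end would put `S` in some `G l` with `l ≥ N`.
  refine tsum_aspect_ne_top h1 h2 h3 (Nat.cast_nonneg N) (fun n => ?_) h5
  by_contra hcon
  push Not at hcon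
  obtain ⟨l, hl⟩ := Int.eq_ofNat_of_zero_le (sub_nonneg.mpr (h1 n))
  have hlr : (b' n - a' n : ℝ) = l := by exact_mod_cast hl
  rw [hlr] at hcon
  have hb : b' n = a' n + l := by omega
  refine hN l (by exact_mod_cast hcon.1.le) ?_
  refine Set.mem_biUnion (x := a' n) ?_ ?_
  · have : |a' n| ≤ 2 * ((l : ℤ) + 1) ^ 4 := by exact_mod_cast hcon.2.le
    exact Finset.mem_coe.mpr (Finset.mem_Icc.mpr (abs_le.mp this))
  · have := h4 n
    rw [hb, ← Finset.coe_Icc, Set.ncard_coe_finset] at this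
    exact this

theorem ae_hasSubstantialIntervals
    (hP : ∀ F : Finset ℤ, (P.map compl) {S | (F : Set ℤ) ⊆ S} ≤ ENNReal.ofReal ((1 - a) ^ F.card))
    (ha : a ≤ 1) {D : ℝ} (hD : D < a) : ∀ᵐ S ∂P, HasSubstantialIntervals S D := by
  obtain ⟨ρ, hρ0, hρ1, hρ⟩ := exists_measure_density_ge_le hP (sub_nonneg.mpr ha)
    (sub_lt_sub_left hD 1)
  let I : ℕ → Finset ℤ := fun n => Finset.Icc (2 ^ n) (2 ^ (n + 1) - 1)
  have hIcard : ∀ n, (I n).card = 2 ^ n := by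
    intro n
    simp only [I, Int.card_Icc]
    have : (2 : ℤ) ^ (n + 1) - 1 + 1 - 2 ^ n = ((2 ^ n : ℕ) : ℤ) := by push_cast; ring
    rw [this, Int.toNat_natCast]
  have hfin : ∑' n, (P.map compl) {S | (1 - D) * (I n).card ≤ ((S ∩ I n).ncard : ℝ)} ≠ ⊤ := by
    have hgeo : Summable fun n : ℕ => ρ ^ n := summable_geometric_of_lt_one hρ0.le hρ1
    refine ne_top_of_le_ne_top hgeo.tsum_ofReal_ne_top (ENNReal.tsum_le_tsum fun n => ?_)
    refine (hρ (I n)).trans (ENNReal.ofReal_le_ofReal ?_)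
    rw [hIcard]
    exact pow_le_pow_of_le_one hρ0.le hρ1.le Nat.lt_two_pow_self.le
  have hae := ae_of_ae_map measurable_compl.aemeasurable (ae_eventually_notMem hfin)
  filter_upwards [hae] with S hS
  obtain ⟨N, hN⟩ := Filter.eventually_atTop.mp hS
  have hpow1 : ∀ n : ℕ, (1 : ℤ) ≤ 2 ^ n := fun n => one_le_pow₀ (by norm_num)
  have hle : ∀ n : ℕ, (2 : ℤ) ^ n ≤ 2 ^ (n + 1) - 1 := fun n => by
    have := hpow1 n; rw [pow_succ]; omega
  -- The extra `1` in the exponent keeps the left end at least `2`, so every aspect is at least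
  -- `3/2`.
  refine ⟨fun n => 2 ^ (n + N + 1), fun n => 2 ^ (n + N + 1 + 1) - 1, fun n => hle _, fun n h => ?_,
    ?_, fun n => ?_, ?_⟩
  · have h1 : (2 : ℤ) ^ (n + N + 1) ≤ 0 := h.1
    have := hpow1 (n + N + 1)
    omega
  · have hlt : ∀ m n : ℕ, m < n → Disjoint
        (Set.Icc ((2 : ℤ) ^ (m + N + 1)) (2 ^ (m + N + 1 + 1) - 1))
        (Set.Icc ((2 : ℤ) ^ (n + N + 1)) (2 ^ (n + N + 1 + 1) - 1)) := by
      intro m n hmn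
      refine Set.disjoint_left.mpr fun k hk hk' => ?_
      have h1 := hk.2
      have h2 := hk'.1
      have h3 : (2 : ℤ) ^ (m + N + 1 + 1) ≤ 2 ^ (n + N + 1) :=
        pow_le_pow_right₀ (by norm_num) (by omega)
      omega
    intro m n hmn
    rcases lt_or_gt_of_ne hmn with h | h
    · exact hlt m n h
    · exact (hlt n m h).symm
  · have hn := hN (n + N + 1) (by omega)
    have hn' : ((Sᶜ ∩ I (n + N + 1)).ncard : ℝ) < (1 - D) * (I (n + N + 1)).card := not_le.mp hn
    have hadd : (S ∩ I (n + N + 1)).ncard + (Sᶜ ∩ I (n + N + 1)).ncard =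
        (I (n + N + 1)).card := by
      rw [← Set.ncard_coe_finset, Set.inter_comm, Set.inter_comm Sᶜ, ← Set.sdiff_eq]
      exact Set.ncard_inter_add_ncard_sdiff_eq_ncard _ _ (Finset.finite_toSet _)
    have hadd' : ((S ∩ I (n + N + 1)).ncard : ℝ) + ((Sᶜ ∩ I (n + N + 1)).ncard : ℝ) =
        (I (n + N + 1)).card := by exact_mod_cast hadd
    rw [← Finset.coe_Icc, Set.ncard_coe_finset]
    change D * ((I (n + N + 1)).card : ℝ) ≤ ((S ∩ I (n + N + 1)).ncard : ℝ)
    linarith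
  · refine top_unique ?_
    have hconst : ∑' _ : ℕ, ENNReal.ofReal ((1 / 2 : ℝ) ^ 2) = ⊤ :=
      ENNReal.tsum_const_eq_top_of_ne_zero (by simp)
    rw [← hconst]
    refine ENNReal.tsum_le_tsum fun n => ENNReal.ofReal_le_ofReal ?_
    refine pow_le_pow_left₀ (by norm_num) ?_ 2
    have hp : (2 : ℝ) ≤ 2 ^ (n + N + 1) := by
      calc (2 : ℝ) = 2 ^ 1 := (pow_one 2).symm
        _ ≤ 2 ^ (n + N + 1) := pow_le_pow_right₀ (by norm_num) (by omega)
    have hq : (2 : ℝ) ^ (n + N + 1) ≤ 2 ^ (n + N + 1 + 1) - 1 := by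
      rw [pow_succ 2 (n + N + 1)]; linarith
    rw [aspect]
    push_cast
    rw [abs_of_pos (by positivity), abs_of_pos (by linarith), max_eq_right hq, min_eq_left hq,
      le_sub_iff_add_le, le_div_iff₀ (by positivity), pow_succ 2 (n + N + 1)]
    linarith

lemma beurlingMalliavinDensity_eq {S : Set ℤ} (ha : 0 ≤ a)
    (hlt : ∀ k : ℕ, HasSubstantialIntervals S (a - 1 / (k + 1)))
    (hgt : ∀ k : ℕ, ¬ HasSubstantialIntervals S (a + 1 / (k + 1))) :
    beurlingMalliavinDensity S = a := by
  have hub : ∀ D ∈ {D : ℝ | 0 ≤ D ∧ HasSubstantialIntervals S D}, D ≤ a := by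
    rintro D ⟨_, hD⟩
    by_contra! h
    obtain ⟨k, hk⟩ := exists_nat_one_div_lt (sub_pos.mpr h)
    exact hgt k (hD.mono (by linarith))
  refine le_antisymm (Real.sSup_le hub ha) (le_of_forall_pos_lt_add fun ε hε => ?_)
  obtain ⟨k, hk⟩ := exists_nat_one_div_lt hε
  -- A negative value is not in the set defining the density; nonnegativity of the supremum then
  -- suffices.
  rcases le_or_gt 0 (a - 1 / ((k : ℝ) + 1)) with h | h
  · have : a - 1 / ((k : ℝ) + 1) ≤ beurlingMalliavinDensity S := le_csSup ⟨a, hub⟩ ⟨h, hlt k⟩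
    linarith
  · have : 0 ≤ beurlingMalliavinDensity S := Real.sSup_nonneg fun D hD => hD.1
    linarith

end Density

/-! ### Both almost sure properties for the Toeplitz kernel. -/

section Toeplitz

variable {A : Set UnitAddCircle} {P : Measure (Set ℤ)}

/-- `F ⊆ S` says that the complement of `S` misses `F`; `cylinderDet_empty_le_prod` applies to `1 -
Q`, whose diagonal entries are `1 - |A|`. -/
lemma HasCylinderDet.measure_superset_le (hA : NullMeasurableSet A circleMeasure)
    (hP : HasCylinderDet P (toeplitzMatrix A)) (F : Finset ℤ) :
    P {S | (F : Set ℤ) ⊆ S} ≤ ENNReal.ofReal (circleMeasure.real A ^ F.card) := by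
  have h : {S : Set ℤ | (F : Set ℤ) ⊆ S} = {S | ∀ i ∈ F, i ∈ S ↔ i ∈ (∅ : Set ℤ)ᶜ} := by
    ext S; simp [Set.subset_def]
  rw [h, hP, cylinderDet_compl]
  refine ENNReal.ofReal_le_ofReal ((cylinderDet_empty_le_prod
    (isPosContraction_toeplitzMatrix hA).one_sub_self F).trans (le_of_eq ?_))
  rw [← Finset.prod_const]
  refine Finset.prod_congr rfl fun i _ => ?_
  rw [Matrix.sub_apply, Matrix.one_apply_eq, toeplitzMatrix_self hA]
  simp

lemma HasCylinderDet.compl_toeplitzMatrix (hA : NullMeasurableSet A circleMeasure)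
    (hP : HasCylinderDet P (toeplitzMatrix A)) :
    HasCylinderDet (P.map compl) (toeplitzMatrix Aᶜ) :=
  one_sub_toeplitzMatrix hA ▸ hP.map_compl

theorem HasCylinderDet.ae_beurlingMalliavinDensity (hA : NullMeasurableSet A circleMeasure)
    (hP : HasCylinderDet P (toeplitzMatrix A)) :
    ∀ᵐ S ∂P, beurlingMalliavinDensity S = circleMeasure.real A := by
  have hcompl : ∀ F : Finset ℤ, (P.map compl) {S | (F : Set ℤ) ⊆ S} ≤
      ENNReal.ofReal ((1 - circleMeasure.real A) ^ F.card) := by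
    intro F
    have := (hP.compl_toeplitzMatrix hA).measure_superset_le hA.compl F
    rwa [measureReal_compl₀ hA, probReal_univ] at this
  have hlt : ∀ᵐ S ∂P, ∀ k : ℕ, HasSubstantialIntervals S (circleMeasure.real A - 1 / (k + 1)) :=
    ae_all_iff.mpr fun k => ae_hasSubstantialIntervals hcompl measureReal_le_one
      (sub_lt_self _ Nat.one_div_pos_of_nat)
  have hgt : ∀ᵐ S ∂P, ∀ k : ℕ, ¬ HasSubstantialIntervals S (circleMeasure.real A + 1 / (k + 1)) :=
    ae_all_iff.mpr fun k => ae_not_hasSubstantialIntervals (hP.measure_superset_le hA)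
      measureReal_nonneg (lt_add_of_pos_right _ Nat.one_div_pos_of_nat)
  filter_upwards [hlt, hgt] with S h1 h2
  exact beurlingMalliavinDensity_eq measureReal_nonneg h1 h2

/-- The complement process has the kernel of `Aᶜ`, and completeness for it is uniqueness for `A` and
`S`. -/
theorem HasCylinderDet.ae_isUniquenessSet (hA : NullMeasurableSet A circleMeasure)
    (hP : HasCylinderDet P (toeplitzMatrix A)) : ∀ᵐ S ∂P, IsUniquenessSet A S := by
  have h := (hP.compl_toeplitzMatrix hA).ae_isUniquenessSet_compl hA.compl
  filter_upwards [ae_of_ae_map measurable_compl.aemeasurable h] with S hS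
  simpa only [compl_compl] using hS

end Toeplitz

end

theorem mainTheorem4 (A : Set UnitAddCircle) (hA : NullMeasurableSet A circleMeasure) :
    (∃ S : Set ℤ, beurlingMalliavinDensity S = circleMeasure.real A ∧ IsUniquenessSet A S) ∧
    (∃ P : Measure (Set ℤ), IsDeterminantal P (toeplitzMatrix A) ∧
      (∀ P' : Measure (Set ℤ), IsDeterminantal P' (toeplitzMatrix A) → P' = P) ∧
      ∀ᵐ S ∂P, beurlingMalliavinDensity S = circleMeasure.real A ∧ IsUniquenessSet A S) := by
  have hQ := isPosContraction_toeplitzMatrix hA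
  obtain ⟨P, hP⟩ := exists_hasCylinderDet hQ
  have hdet := hP.isDeterminantal hQ
  have hae : ∀ᵐ S ∂P,
      beurlingMalliavinDensity S = circleMeasure.real A ∧ IsUniquenessSet A S :=
    (hP.ae_beurlingMalliavinDensity hA).and (hP.ae_isUniquenessSet hA)
  have := hP.isProbabilityMeasure
  exact ⟨hae.exists, P, hdet, fun P' hP' => hdet.eq hP', hae⟩
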